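/- Let $G$ be a continuous family groupoid: a second countable, locally compact Hausdorff groupoid with unit space $G^0$ such that $(G,r)$ and $(G,s)$ are continuous families of manifolds over $G^0$ (that is, $G$ is covered by fibre-preserving charts onto products $U\times V$, $U\subset G^0$, $V\subset\mathbb R^k$ open, $k\ge 1$, whose coordinate changes are $C^{\infty,0}$: smooth along the fibres, with all fibrewise derivatives jointly continuous), inversion is a $C^{\infty,0}$ diffeomorphism from $(G,r)$ to $(G,s)$, and multiplication is a $C^{\infty,0}$ map. Let $(X,p)$ be a second countable, locally compact Hausdorff, proper, $G$-compact, $C^{\infty,0}$ $G$-space, where $p:X\to G^0$ is a continuous open surjection; write $X^u=p^{-1}(u)$, $G^u=r^{-1}(u)$, $G_u=s^{-1}(u)$. Let $\{\lambda^u\}$ and $\{\mu^u\}$ be $C^{\infty,0}$ left Haar systems on $G$ and on $X$. Let $E$ be a $C^{\infty,0}$ complex $G$-vector bundle over $X$ with a $G$-isometric $C^{\infty,0}$ hermitian metric $\langle\,,\rangle$, taken linear in the first variable and conjugate linear in the second. For a section $k$ of $E$ put $L_gk(x)=g\,[k(g^{-1}x)]$ for $x\in X^{r(g)}$. Let $C_c(G)$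 carry the convolution product and involution $$f*h(x)=\int_{G^{r(x)}} f(t)h(t^{-1}x)\,d\lambda^{r(x)}(t),\qquad f^*(x)=\overline{f(x^{-1})},$$ and let $C^*_{red}(G)$ be its completion for the norm $\|f\|_{red}=\sup_{u\in G^0}\|\pi_u(f)\|$, where $\pi_u(f)\xi=f*\xi$ on $L^2(G,\lambda_u)$, $\lambda_u=(\lambda^u)^{-1}$ being the image of $\lambda^u$ on $G_u$ under inversion. (In particular each $\pi_u(f)$ is bounded, the supremum is a finite norm, and $C_c(G)$ is a dense $*$-subalgebra of $C^*_{red}(G)$.) Then the space $C_c(X,E)$ of continuous compactly supported sections of $E$ is a right pre-Hilbert module over the pre-$C^*$-algebra $C_c(G)\subset C^*_{red}(G)$, with $C_c(G)$-valued inner product and module action $$\langle k_1,k_2\rangle(g)=\int_{X^{r(g)}}\overline{\langle k_1(x),L_gk_2(x)\rangle}\,d\mu^{r(g)}(x),\qquad (kf)(x)=\int_{G^{p(x)}}L_gk(x)\,f(g^{-1})\,d\lambda^{p(x)}(g).$$ That is: these integrals converge and define elements of $C_c(G)$ and $C_c(X,E)$ respectively; the action is bilinear and $(kf)h=k(f*h)$;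 the inner product is linear in the second variable, $\langle k_1,k_2f\rangle=\langle k_1,k_2\rangle*f$, $\langle k_1,k_2\rangle^*=\langle k_2,k_1\rangle$, $\langle k,k\rangle\ge 0$ in $C^*_{red}(G)$, and $\langle k,k\rangle=0$ only if $k=0$. Moreover $k\mapsto\|\langle k,k\rangle\|_{red}^{1/2}$ is a norm on $C_c(X,E)$, and the inner product and the action extend to the completion $\Gamma(E)$ of $C_c(X,E)$ for this norm and make $\Gamma(E)$ a Hilbert $C^*_{red}(G)$-module. -/

import Mathlib

open MeasureTheory Set Topology Bundle
open scoped ContDiff ENNReal CompactlySupported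

noncomputable section

namespace CFG

universe uG uB uX uT uE

/-! ### Continuous families of manifolds -/

/-- The model space of the fibres of a `k`-dimensional continuous family. -/
abbrev Coord (k : ℕ) : Type := EuclideanSpace ℝ (Fin k)

/-- `f` is `C^{∞,0}` on the open set `U ⊆ T × M`: each partial map `f(t, ·)` is smooth, and all its
derivatives along `M` are jointly continuous on `U`. (For `M` locally compact this is the continuity
of `t ↦ f(t, ·)` for the topology of uniform convergence on compact sets of all derivatives.) -/
def CInfZeroOn {T M N : Type*} [TopologicalSpace T] [NormedAddCommGroup M] [NormedSpace ℝ M]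
    [NormedAddCommGroup N] [NormedSpace ℝ N] (f : T × M → N) (U : Set (T × M)) : Prop :=
  (∀ z ∈ U, ContDiffAt ℝ ∞ (fun w => f (z.1, w)) z.2) ∧
    ∀ n : ℕ, ContinuousOn (fun z : T × M => iteratedFDeriv ℝ n (fun w => f (z.1, w)) z.2) U

/-- A continuous family of `k`-dimensional manifolds over `T`, given by an atlas of fibre preserving
homeomorphisms `U ≃ p(U) × V` with `V` open in `ℝ^k` and `C^{∞,0}` coordinate changes. As for
manifolds, an atlas determines the maximal one. -/
structure ContFamily {X : Type uX} {T : Type uT} [TopologicalSpace X] [TopologicalSpace T]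
    (p : X → T) (k : ℕ) where
  continuous_proj : Continuous p
  isOpenMap_proj : IsOpenMap p
  surjective_proj : Function.Surjective p
  one_le_dim : 1 ≤ k
  atlas : Set (OpenPartialHomeomorph X (T × Coord k))
  cover : ∀ x, ∃ φ ∈ atlas, x ∈ φ.source
  fst_chart : ∀ φ ∈ atlas, ∀ x ∈ φ.source, (φ x).1 = p x
  target_chart : ∀ φ ∈ atlas, ∃ V : Set (Coord k), IsOpen V ∧ φ.target = (p '' φ.source) ×ˢ V
  compatible : ∀ φ ∈ atlas, ∀ ψ ∈ atlas,
    CInfZeroOn (fun z => (ψ (φ.symm z)).2) (φ.target ∩ φ.symm ⁻¹' ψ.source)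

/-- `C^{∞,0}` functions with values in a normed space, on an open subset `O` of a continuous
family. -/
def ContFamily.SmoothOn {X : Type uX} {T : Type uT} [TopologicalSpace X] [TopologicalSpace T]
    {p : X → T} {k : ℕ} (𝔛 : ContFamily p k) {N : Type*} [NormedAddCommGroup N] [NormedSpace ℝ N]
    (f : X → N) (O : Set X) : Prop :=
  ∀ φ ∈ 𝔛.atlas, CInfZeroOn (fun z => f (φ.symm z)) (φ.target ∩ φ.symm ⁻¹' O)

/-- The pair `(f, q)` is a morphism (a `C^{∞,0}` map) of continuous families. -/
structure IsMorphism {X₁ X₂ T₁ T₂ : Type*} [TopologicalSpace X₁] [TopologicalSpace X₂]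
    [TopologicalSpace T₁] [TopologicalSpace T₂] {p₁ : X₁ → T₁} {p₂ : X₂ → T₂} {k₁ k₂ : ℕ}
    (𝔛₁ : ContFamily p₁ k₁) (𝔛₂ : ContFamily p₂ k₂) (f : X₁ → X₂) (q : T₁ → T₂) : Prop where
  continuous : Continuous f
  continuous_base : Continuous q
  fibre : ∀ x, p₂ (f x) = q (p₁ x)
  smooth : ∀ φ ∈ 𝔛₁.atlas, ∀ ψ ∈ 𝔛₂.atlas,
    CInfZeroOn (fun z => (ψ (f (φ.symm z))).2) (φ.target ∩ φ.symm ⁻¹' (f ⁻¹' ψ.source))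

/-! ### Groupoids and their actions -/

/-- A topological groupoid with space of arrows `G` and space of units `B`, the latter being
identified with a subspace of `G` by `unit`. The product `mul g h` is meaningful only if
`s g = r h`; its values at the other pairs are irrelevant. -/
structure TopGroupoid (G : Type uG) (B : Type uB) [TopologicalSpace G] [TopologicalSpace B] where
  r : G → B
  s : G → B
  unit : B → G
  inv : G → G
  mul : G → G → G
  r_unit : ∀ u, r (unit u) = u
  s_unit : ∀ u, s (unit u) = u
  r_inv : ∀ g, r (inv g) = s g
  s_inv : ∀ g, s (inv g) = r g
  r_mul : ∀ g h, s g = r h → r (mul g h) = r g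
  s_mul : ∀ g h, s g = r h → s (mul g h) = s h
  mul_assoc : ∀ g h l, s g = r h → s h = r l → mul (mul g h) l = mul g (mul h l)
  unit_mul : ∀ g, mul (unit (r g)) g = g
  mul_unit : ∀ g, mul g (unit (s g)) = g
  mul_inv : ∀ g, mul g (inv g) = unit (r g)
  inv_mul : ∀ g, mul (inv g) g = unit (s g)
  continuous_r : Continuous r
  continuous_s : Continuous s
  continuous_unit : Continuous unit
  continuous_inv : Continuous inv
  continuousOn_mul : ContinuousOn (fun z : G × G => mul z.1 z.2) {z | s z.1 = r z.2}

variable {G : Type uG} {B : Type uB} [TopologicalSpace G] [TopologicalSpace B]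

/-- A continuous action of a groupoid on a space `X` over its space of units. The value `smul g x`
is meaningful only if `s g = p x`. -/
structure GroupoidAction (𝒢 : TopGroupoid G B) {X : Type uX} [TopologicalSpace X] (p : X → B) where
  smul : G → X → X
  p_smul : ∀ g x, 𝒢.s g = p x → p (smul g x) = 𝒢.r g
  smul_smul : ∀ g h x, 𝒢.s g = 𝒢.r h → 𝒢.s h = p x → smul g (smul h x) = smul (𝒢.mul g h) x
  inv_smul_smul : ∀ g x, 𝒢.s g = p x → smul (𝒢.inv g) (smul g x) = x
  continuousOn_smul : ContinuousOn (fun z : G × X => smul z.1 z.2) {z | 𝒢.s z.1 = p z.2}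

/-- The action of `G` on `(G, r)` by left multiplication. -/
def TopGroupoid.leftMul (𝒢 : TopGroupoid G B) : GroupoidAction 𝒢 𝒢.r where
  smul := 𝒢.mul
  p_smul := 𝒢.r_mul
  smul_smul g h x h₁ h₂ := (𝒢.mul_assoc g h x h₁ h₂).symm
  inv_smul_smul g x h := by
    rw [← 𝒢.mul_assoc _ _ _ (𝒢.s_inv g) h, 𝒢.inv_mul, h, 𝒢.unit_mul]
  continuousOn_smul := 𝒢.continuousOn_mul

section Action

variable {𝒢 : TopGroupoid G B} {X : Type uX} [TopologicalSpace X] {p : X → B}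

/-- The map `(g, x) ↦ (gx, x)` from `G * X` to `X × X` is proper. -/
def GroupoidAction.IsProper (α : GroupoidAction 𝒢 p) : Prop :=
  ∀ K : Set (X × X), IsCompact K →
    IsCompact {z : G × X | 𝒢.s z.1 = p z.2 ∧ (α.smul z.1 z.2, z.2) ∈ K}

/-- `X = G C` for some compact set `C`. -/
def GroupoidAction.IsGCompact (α : GroupoidAction 𝒢 p) : Prop :=
  ∃ C : Set X, IsCompact C ∧ ∀ x, ∃ g, ∃ y ∈ C, 𝒢.s g = p y ∧ α.smul g y = x

/-- The pair (action map, `r`) is a morphism from `(G * X, t₁)` to `(X, p)`, where `t₁ (g, x) = g`.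
The charts of the pull-back family `(G * X, t₁)` over `G` are `(g, x) ↦ (g, w)` with
`φ x = (s g, w)` for a chart `φ` of `(X, p)`. -/
def GroupoidAction.IsSmooth (α : GroupoidAction 𝒢 p) {k : ℕ} (𝔛 : ContFamily p k) : Prop :=
  ∀ φ ∈ 𝔛.atlas, ∀ ψ ∈ 𝔛.atlas,
    CInfZeroOn (fun z : G × Coord k => (ψ (α.smul z.1 (φ.symm (𝒢.s z.1, z.2)))).2)
      {z | (𝒢.s z.1, z.2) ∈ φ.target ∧ α.smul z.1 (φ.symm (𝒢.s z.1, z.2)) ∈ ψ.source}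

/-- A `C^{∞,0}` left Haar system on the `C^{∞,0}` `G`-space `(X, p)`. The measure on the fibre `X^u`
is regarded as a measure on `X` that is concentrated on `X^u`. -/
structure SmoothHaarSystem (α : GroupoidAction 𝒢 p) {k : ℕ} (𝔛 : ContFamily p k)
    [MeasurableSpace X] where
  meas : B → Measure X
  finite_on_compacts : ∀ u, IsFiniteMeasureOnCompacts (meas u)
  concentrated : ∀ u, meas u (p ⁻¹' {u})ᶜ = 0
  full_support : ∀ u, ∀ V : Set X, IsOpen V → (V ∩ p ⁻¹' {u}).Nonempty → 0 < meas u V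
  smooth : ∀ φ ∈ 𝔛.atlas, ∃ ρ : B × Coord k → ℝ,
    CInfZeroOn ρ φ.target ∧ (∀ z ∈ φ.target, 0 ≤ ρ z) ∧
    ∀ u, ((meas u).restrict φ.source).map (fun x => (φ x).2) =
        (volume.restrict {w | (u, w) ∈ φ.target}).withDensity (fun w => ENNReal.ofReal (ρ (u, w))) ∧
      volume.restrict {w | (u, w) ∈ φ.target} ≪
        ((meas u).restrict φ.source).map (fun x => (φ x).2)
  invariant : ∀ g, ∀ f : C_c(X, ℂ),
    ∫ x, f (α.smul g x) ∂(meas (𝒢.s g)) = ∫ x, f x ∂(meas (𝒢.r g))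

end Action

/-- The structure of a continuous family groupoid: `(G, r)` and `(G, s)` are continuous families
over the unit space, inversion is a diffeomorphism between them, and multiplication is a morphism
from `(G * G, t₁)` to `(G, r)`. -/
structure ContFamilyGroupoid (𝒢 : TopGroupoid G B) (k : ℕ) where
  famR : ContFamily 𝒢.r k
  dimS : ℕ
  famS : ContFamily 𝒢.s dimS
  inv_morphism : IsMorphism famR famS 𝒢.inv id
  inv_morphism' : IsMorphism famS famR 𝒢.inv id
  mul_morphism : 𝒢.leftMul.IsSmooth famR

/-! ### `G`-vector bundles -/

section VectorBundle

variable {X : Type uX} [TopologicalSpace X]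

/-- The model fibre of complex vector bundles of rank `q`. -/
abbrev Fib (q : ℕ) : Type := EuclideanSpace ℂ (Fin q)

variable {q : ℕ} {E : X → Type uE}

/-- A point of the total space lying over `x`, as an element of the fibre `E x`. -/
def toFibre [∀ x, Zero (E x)] (x : X) (e : TotalSpace (Fib q) E) : E x :=
  open Classical in if h : e.proj = x then h ▸ e.snd else 0

variable [∀ x, NormedAddCommGroup (E x)] [∀ x, InnerProductSpace ℂ (E x)]
  [TopologicalSpace (TotalSpace (Fib q) E)] [FiberBundle (Fib q) E] [VectorBundle ℂ (Fib q) E]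

/-- A `C^{∞,0}` structure on the continuous complex vector bundle `E`: local trivializations with
`C^{∞,0}` transition functions. -/
structure SmoothBundle {B : Type uB} [TopologicalSpace B] {p : X → B} {k : ℕ}
    (𝔛 : ContFamily p k) (q : ℕ) (E : X → Type uE)
    [∀ x, NormedAddCommGroup (E x)] [∀ x, InnerProductSpace ℂ (E x)]
    [TopologicalSpace (TotalSpace (Fib q) E)] [FiberBundle (Fib q) E]
    [VectorBundle ℂ (Fib q) E] where
  trivs : Set (Trivialization (Fib q) (π (Fib q) E))
  linear : ∀ e ∈ trivs, e.IsLinear ℂ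
  cover : ∀ x, ∃ e ∈ trivs, x ∈ e.baseSet
  smooth : ∀ e ∈ trivs, ∀ e' ∈ trivs, ∀ v : Fib q,
    𝔛.SmoothOn (fun x => (e' ⟨x, e.symm x v⟩).2) (e.baseSet ∩ e'.baseSet)

/-- The hermitian metric given by the inner products of the fibres is `C^{∞,0}`: its matrix entries
in the `C^{∞,0}` local trivializations are `C^{∞,0}`. -/
def SmoothBundle.SmoothMetric {B : Type uB} [TopologicalSpace B] {p : X → B} {k : ℕ}
    {𝔛 : ContFamily p k} (𝔈 : SmoothBundle 𝔛 q E) : Prop :=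
  ∀ e ∈ 𝔈.trivs, ∀ v w : Fib q,
    𝔛.SmoothOn (fun x => inner ℂ (e.symm x v) (e.symm x w)) e.baseSet

/-- The structure of a `C^{∞,0}` `G`-vector bundle: `G` acts on the total space, over the action on
`X`, by linear maps between fibres, and the action is `C^{∞,0}`. The charts of the pull-back of the
total space to `G` are `(g, e) ↦ (g, w, v)`, where `w` and `v` are the coordinates of the base point
and of the vector `e`. -/
structure GBundle {𝒢 : TopGroupoid G B} {p : X → B} (α : GroupoidAction 𝒢 p) {k : ℕ}
    {𝔛 : ContFamily p k} (𝔈 : SmoothBundle 𝔛 q E) where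
  act : GroupoidAction 𝒢 (fun e : TotalSpace (Fib q) E => p e.proj)
  proj_smul : ∀ g e, 𝒢.s g = p e.proj → (act.smul g e).proj = α.smul g e.proj
  smul_add : ∀ g x, 𝒢.s g = p x → ∀ v w : E x,
    toFibre (α.smul g x) (act.smul g ⟨x, v + w⟩) =
      toFibre (α.smul g x) (act.smul g ⟨x, v⟩) + toFibre (α.smul g x) (act.smul g ⟨x, w⟩)
  smul_smul : ∀ g x, 𝒢.s g = p x → ∀ (c : ℂ) (v : E x),
    toFibre (α.smul g x) (act.smul g ⟨x, c • v⟩) =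
      c • toFibre (α.smul g x) (act.smul g ⟨x, v⟩)
  smooth : ∀ φ ∈ 𝔛.atlas, ∀ e ∈ 𝔈.trivs, ∀ e' ∈ 𝔈.trivs,
    CInfZeroOn
      (fun z : G × (Coord k × Fib q) =>
        (e' (act.smul z.1 ⟨φ.symm (𝒢.s z.1, z.2.1), e.symm (φ.symm (𝒢.s z.1, z.2.1)) z.2.2⟩)).2)
      {z | (𝒢.s z.1, z.2.1) ∈ φ.target ∧ φ.symm (𝒢.s z.1, z.2.1) ∈ e.baseSet ∧
        α.smul z.1 (φ.symm (𝒢.s z.1, z.2.1)) ∈ e'.baseSet}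

/-- The hermitian metric is `G`-isometric. -/
def GBundle.IsIsometric {𝒢 : TopGroupoid G B} {p : X → B} {α : GroupoidAction 𝒢 p} {k : ℕ}
    {𝔛 : ContFamily p k} {𝔈 : SmoothBundle 𝔛 q E} (𝒜 : GBundle α 𝔈) : Prop :=
  ∀ g x, 𝒢.s g = p x → ∀ v w : E x,
    inner ℂ (toFibre (α.smul g x) (𝒜.act.smul g ⟨x, v⟩))
      (toFibre (α.smul g x) (𝒜.act.smul g ⟨x, w⟩)) = inner ℂ v w

/-- `L_g k (x) = g [k (g⁻¹ x)]`, for `p x = r g`. -/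
def GBundle.translate {𝒢 : TopGroupoid G B} {p : X → B} {α : GroupoidAction 𝒢 p} {k : ℕ}
    {𝔛 : ContFamily p k} {𝔈 : SmoothBundle 𝔛 q E} (𝒜 : GBundle α 𝔈) (g : G) (ξ : ∀ x, E x)
    (x : X) : E x :=
  toFibre x (𝒜.act.smul g ⟨α.smul (𝒢.inv g) x, ξ (α.smul (𝒢.inv g) x)⟩)

variable (q E) in
/-- The space `C_c(X, E)` of continuous sections of `E` with compact support. -/
def CcSection : Submodule ℂ (∀ x, E x) where
  carrier := {k | Continuous (fun x => (⟨x, k x⟩ : TotalSpace (Fib q) E)) ∧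
    ∃ K : Set X, IsCompact K ∧ ∀ x, x ∉ K → k x = 0}
  zero_mem' := by
    refine ⟨?_, ∅, isCompact_empty, fun _ _ => rfl⟩
    rw [continuous_iff_continuousAt]
    intro x₀
    refine (FiberBundle.continuousAt_totalSpace (Fib q) _).2 ⟨continuousAt_id, ?_⟩
    refine (continuousAt_const (y := (0 : Fib q))).congr ?_
    filter_upwards [(trivializationAt (Fib q) E x₀).open_baseSet.mem_nhds
      (FiberBundle.mem_baseSet_trivializationAt' x₀)] with x hx
    exact (((trivializationAt (Fib q) E x₀).linear ℂ hx).map_zero).symm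
  add_mem' := by
    rintro k l ⟨hk, K, hK, hk0⟩ ⟨hl, L, hL, hl0⟩
    refine ⟨?_, K ∪ L, hK.union hL, fun x hx => ?_⟩
    · rw [continuous_iff_continuousAt] at hk hl ⊢
      intro x₀
      have h1 := (FiberBundle.continuousAt_totalSpace (Fib q) _).1 (hk x₀)
      have h2 := (FiberBundle.continuousAt_totalSpace (Fib q) _).1 (hl x₀)
      refine (FiberBundle.continuousAt_totalSpace (Fib q) _).2 ⟨h1.1, ?_⟩
      refine (h1.2.add h2.2).congr ?_
      filter_upwards [(trivializationAt (Fib q) E x₀).open_baseSet.mem_nhds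
        (FiberBundle.mem_baseSet_trivializationAt' x₀)] with x hx
      exact (((trivializationAt (Fib q) E x₀).linear ℂ hx).map_add (k x) (l x)).symm
    · simp only [Set.mem_union, not_or] at hx
      simp [hk0 x hx.1, hl0 x hx.2]
  smul_mem' := by
    rintro c k ⟨hk, K, hK, hk0⟩
    refine ⟨?_, K, hK, fun x hx => by simp [hk0 x hx]⟩
    rw [continuous_iff_continuousAt] at hk ⊢
    intro x₀
    have h1 := (FiberBundle.continuousAt_totalSpace (Fib q) _).1 (hk x₀)
    refine (FiberBundle.continuousAt_totalSpace (Fib q) _).2 ⟨h1.1, ?_⟩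
    refine (h1.2.const_smul c).congr ?_
    filter_upwards [(trivializationAt (Fib q) E x₀).open_baseSet.mem_nhds
      (FiberBundle.mem_baseSet_trivializationAt' x₀)] with x hx
    exact (((trivializationAt (Fib q) E x₀).linear ℂ hx).map_smul c (k x)).symm

end VectorBundle

/-! ### The reduced C*-algebra -/

section Reduced

variable [MeasurableSpace G]

/-- The convolution product `(f * g)(x) = ∫ f(t) g(t⁻¹ x) dλ^{r(x)}(t)`. -/
def conv (𝒢 : TopGroupoid G B) (lam : B → Measure G) (f g : G → ℂ) (x : G) : ℂ :=
  ∫ t, f t * g (𝒢.mul (𝒢.inv t) x) ∂(lam (𝒢.r x))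

/-- The measure `λ_u = (λ^u)⁻¹` on `G_u`. -/
def rightMeas (𝒢 : TopGroupoid G B) (lam : B → Measure G) (u : B) : Measure G :=
  (lam u).map 𝒢.inv

/-- The bounded operator `T` on `L²(G, λ_u)` is `π_u(f)`, i.e. `T ξ = f * ξ` for `ξ ∈ C_c(G)`. -/
def IsRegRep (𝒢 : TopGroupoid G B) (lam : B → Measure G) (u : B) (f : C_c(G, ℂ))
    (T : Lp ℂ 2 (rightMeas 𝒢 lam u) →L[ℂ] Lp ℂ 2 (rightMeas 𝒢 lam u)) : Prop :=
  ∀ (ξ : C_c(G, ℂ)) (v : Lp ℂ 2 (rightMeas 𝒢 lam u)),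
    v =ᵐ[rightMeas 𝒢 lam u] ξ → T v =ᵐ[rightMeas 𝒢 lam u] conv 𝒢 lam f ξ

/-- The C*-algebra of bounded families of operators on the spaces `L²(G, λ_u)`, with the norm
`‖T‖ = sup_u ‖T_u‖`. -/
def OpFamily (𝒢 : TopGroupoid G B) (lam : B → Measure G) : Type _ :=
  lp (fun u : B => Lp ℂ 2 (rightMeas 𝒢 lam u) →L[ℂ] Lp ℂ 2 (rightMeas 𝒢 lam u)) ∞

instance (𝒢 : TopGroupoid G B) (lam : B → Measure G) : NonUnitalCStarAlgebra (OpFamily 𝒢 lam) :=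
  inferInstanceAs (NonUnitalCStarAlgebra
    (lp (fun u : B => Lp ℂ 2 (rightMeas 𝒢 lam u) →L[ℂ] Lp ℂ 2 (rightMeas 𝒢 lam u)) ∞))

/-- The C*-subalgebra generated by a subset of a C*-algebra. -/
def cstarSpan {A : Type*} [NonUnitalCStarAlgebra A] (S : Set A) : NonUnitalStarSubalgebra ℂ A :=
  (NonUnitalStarAlgebra.adjoin ℂ S).topologicalClosure

/-- The reduced C*-algebra of `G`: the completion of `C_c(G)` for the norm `sup_u ‖π_u(f)‖`, realized
as the C*-algebra generated by the families `(π_u(f))_u` with `f ∈ C_c(G)`. -/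
def CStarRed (𝒢 : TopGroupoid G B) (lam : B → Measure G) : Type _ :=
  cstarSpan {T : OpFamily 𝒢 lam | ∃ f : C_c(G, ℂ), ∀ u, IsRegRep 𝒢 lam u f (T.1 u)}

instance (𝒢 : TopGroupoid G B) (lam : B → Measure G) : NonUnitalCStarAlgebra (CStarRed 𝒢 lam) :=
  have : IsClosed (cstarSpan {T : OpFamily 𝒢 lam |
      ∃ f : C_c(G, ℂ), ∀ u, IsRegRep 𝒢 lam u f (T.1 u)} : Set (OpFamily 𝒢 lam)) :=
    NonUnitalStarSubalgebra.isClosed_topologicalClosure _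
  NonUnitalStarSubalgebra.nonUnitalCStarAlgebra (h_closed := this) (cstarSpan _)

instance (𝒢 : TopGroupoid G B) (lam : B → Measure G) : PartialOrder (CStarRed 𝒢 lam) :=
  CStarAlgebra.spectralOrder _

/-- The component at `u` of an element of the reduced C*-algebra. -/
def CStarRed.op {𝒢 : TopGroupoid G B} {lam : B → Measure G} (a : CStarRed 𝒢 lam) (u : B) :
    Lp ℂ 2 (rightMeas 𝒢 lam u) →L[ℂ] Lp ℂ 2 (rightMeas 𝒢 lam u) :=
  a.1.1 u

end Reduced

/-! ### Hilbert modules -/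

section Modules

variable {A : Type*} [NonUnitalCStarAlgebra A] [PartialOrder A]

/-- `R`, with the product `mul` and the involution `invol`, is embedded by `ι` as a dense
*-subalgebra of the C*-algebra `A`. -/
structure IsDenseStarEmbedding {R : Type*} [AddCommGroup R] [Module ℂ R]
    (mul : R → R → R) (invol : R → R) (ι : R →ₗ[ℂ] A) : Prop where
  injective : Function.Injective ι
  dense : DenseRange ι
  map_mul : ∀ f g, ι (mul f g) = ι f * ι g
  map_invol : ∀ f, ι (invol f) = star (ι f)

/-- `V` is a right pre-Hilbert module, with `R`-valued inner product `ip` and action `act`, over the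
*-subalgebra `R` (with product `mul` and involution `invol`) of `A`. Positivity is positivity
in `A`. -/
structure IsPreHilbertModule {R V : Type*} [AddCommGroup R] [Module ℂ R] [AddCommGroup V]
    [Module ℂ V] (mul : R → R → R) (invol : R → R) (ι : R →ₗ[ℂ] A)
    (ip : V → V → R) (act : V → R → V) : Prop where
  add_act : ∀ k l f, act (k + l) f = act k f + act l f
  act_add : ∀ k f g, act k (f + g) = act k f + act k g
  smul_act : ∀ (c : ℂ) k f, act (c • k) f = c • act k f
  act_smul : ∀ (c : ℂ) k f, act k (c • f) = c • act k f
  act_mul : ∀ k f g, act k (mul f g) = act (act k f) g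
  ip_add : ∀ k l m, ip k (l + m) = ip k l + ip k m
  ip_smul : ∀ (c : ℂ) k l, ip k (c • l) = c • ip k l
  ip_act : ∀ k l f, ip k (act l f) = mul (ip k l) f
  invol_ip : ∀ k l, invol (ip k l) = ip l k
  nonneg : ∀ k, 0 ≤ ι (ip k k)
  definite : ∀ k, ip k k = 0 → k = 0

/-- The Banach space `M` is a (right) Hilbert module over the C*-algebra `A` with inner product `ip`
and action `act`. -/
structure IsHilbertModule {M : Type*} [NormedAddCommGroup M] [NormedSpace ℂ M]
    (ip : M → M → A) (act : M → A → M) : Prop where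
  toPre : IsPreHilbertModule (fun a b : A => a * b) star LinearMap.id ip act
  norm_eq : ∀ x, ‖x‖ = √‖ip x x‖
  complete : CompleteSpace M

/-- `k ↦ ‖⟨k, k⟩‖^{1/2}` is a norm on `V`, and the inner product and the action extend to the
completion of `V` for this norm and make it a Hilbert module over `A`. -/
def CompletionIsHilbertModule {R V : Type*} [AddCommGroup R] [Module ℂ R] [AddCommGroup V]
    [Module ℂ V] (ι : R →ₗ[ℂ] A) (ip : V → V → R) (act : V → R → V) : Prop :=
  letI : Norm V := ⟨fun k => √‖ι (ip k k)‖⟩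
  ∃ hN : NormedSpace.Core ℂ V,
    letI : NormedAddCommGroup V := NormedAddCommGroup.ofCore hN
    letI : NormedSpace ℂ V := NormedSpace.ofCore hN
    ∃ (ip' : UniformSpace.Completion V → UniformSpace.Completion V → A)
      (act' : UniformSpace.Completion V → A → UniformSpace.Completion V),
      IsHilbertModule ip' act' ∧
      (∀ k l : V, ip' (k : UniformSpace.Completion V) (l : UniformSpace.Completion V)
        = ι (ip k l)) ∧
      ∀ (k : V) (f : R), act' (k : UniformSpace.Completion V) (ι f)
        = ((act k f : V) : UniformSpace.Completion V)

end Modules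

end CFG

end

/-! The analytic point is that integrals over the fibres depend continuously on the base point. In a
chart the Haar measures have a jointly continuous density, so a partition of unity settles
integrands continuous on the whole space; `continuous_integral_fibre` passes to integrands
continuous only on the fibre product, by Tietze extension from one fibre. This makes convolution,
action and inner product continuous. Supports are compact because products of compact sets are, and
for the inner product because the action is proper. The algebraic identities are Fubini together
with left invariance.

A Schur test (`exists_norm_toL2_mul_le`) bounds `π_u(f)` uniformly in `u`, and the scalar product of
`η`, `ξ` in `L²(G, λ_u)` is the value of `η^* * ξ` at the unit `u` (`inner_toL2`). Relations between
operators thus become relations in `C_c(G)`.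

Positivity is the heart of the matter. An element of the reduced algebra is positive as soon as all
its components are (`nonneg_of_op`), and for `ξ` in `C_c(G)` one has `⟨ξ, π_u(⟨k,k⟩) ξ⟩ = (ξ^* *
⟨k,k⟩ * ξ)(u) = ⟨kξ, kξ⟩(u) = ∫ ‖kξ‖² dμ^u ≥ 0`. The last equality, applied to `k` itself, also
gives definiteness, since `μ^u` has full support in `X^u`.

The completion is formal: the Cauchy-Schwarz inequality `norm_ip_sq_le` makes inner product and
action bounded, so that they extend, and their identities pass to limits. -/

set_option linter.unusedSectionVars false

noncomputable section

namespace CFG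

universe uG uB uX uT uE

/-! ### Completion of pre-Hilbert modules -/

section Modules

variable {A : Type*} [NonUnitalCStarAlgebra A] [PartialOrder A]
  {R V : Type*} [AddCommGroup R] [Module ℂ R] {mul : R → R → R} {invol : R → R} {ι : R →ₗ[ℂ] A}

namespace IsPreHilbertModule

section Algebra

variable [AddCommGroup V] [Module ℂ V] {ip : V → V → R} {act : V → R → V}
  (h : IsPreHilbertModule mul invol ι ip act) (hι : IsDenseStarEmbedding mul invol ι)

include h hι

lemma star_ip (k l : V) : star (ι (ip k l)) = ι (ip l k) := by
  rw [← hι.map_invol, h.invol_ip]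

omit hι in
lemma ip_zero (k : V) : ip k 0 = 0 := by
  simpa using h.ip_smul 0 k 0

lemma ι_add_left (k l m : V) : ι (ip (k + l) m) = ι (ip k m) + ι (ip l m) := by
  rw [← h.star_ip hι, h.ip_add, map_add, star_add, h.star_ip hι, h.star_ip hι]

lemma ι_smul_left (c : ℂ) (k l : V) : ι (ip (c • k) l) = star c • ι (ip k l) := by
  rw [← h.star_ip hι, h.ip_smul, map_smul, star_smul, h.star_ip hι]

lemma ι_ip_act (k l : V) (f : R) : ι (ip k (act l f)) = ι (ip k l) * ι f := by
  rw [h.ip_act, hι.map_mul]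

lemma ι_act_left (k l : V) (f : R) : ι (ip (act k f) l) = star (ι f) * ι (ip k l) := by
  rw [← h.star_ip hι, h.ι_ip_act hι, star_mul, h.star_ip hι]

lemma eq_zero_of_norm (k : V) (hk : ‖ι (ip k k)‖ = 0) : k = 0 :=
  h.definite k (hι.injective (by rw [norm_eq_zero.1 hk, map_zero]))

variable [StarOrderedRing A]

/-- With `a = ⟨k,l⟩` and `c = ‖⟨k,k⟩‖`, positivity of the square of `ka - cl` and the bound
`a^*⟨k,k⟩a ≤ c a^*a` give `c a^*a ≤ c²⟨l,l⟩`; divide by `c` and take norms. -/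
lemma norm_ip_sq_le (k l : V) : ‖ι (ip k l)‖ ^ 2 ≤ ‖ι (ip k k)‖ * ‖ι (ip l l)‖ := by
  -- The division by `c` fails for `c = 0`, where definiteness gives `k = 0`.
  rcases (norm_nonneg (ι (ip k k))).eq_or_lt with h0 | hpos
  · obtain rfl := h.eq_zero_of_norm hι k h0.symm
    have : ι (ip 0 l) = 0 := by rw [← h.star_ip hι, h.ip_zero, map_zero, star_zero]
    rw [this, norm_zero, zero_pow two_ne_zero]
    positivity
  set c := ‖ι (ip k k)‖ with hc
  set a := ι (ip k l) with ha
  have hsa : star a = ι (ip l k) := h.star_ip hι k l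
  have key : 0 ≤ ι (ip (act k (ip k l) + (-(c : ℂ)) • l) (act k (ip k l) + (-(c : ℂ)) • l)) :=
    h.nonneg _
  have e : ι (ip (act k (ip k l) + (-(c : ℂ)) • l) (act k (ip k l) + (-(c : ℂ)) • l)) =
      star a * ι (ip k k) * a - (c : ℂ) • (star a * a) - (c : ℂ) • (star a * a)
        + (c : ℂ) • (c : ℂ) • ι (ip l l) := by
    rw [h.ip_add, h.ip_smul, map_add, map_smul, h.ι_add_left hι, h.ι_add_left hι,
      h.ι_smul_left hι, h.ι_smul_left hι, h.ι_ip_act hι, h.ι_ip_act hι, h.ι_act_left hι,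
      h.ι_act_left hι, ← hsa, ← ha]
    simp only [star_neg, neg_smul, smul_add, smul_neg, neg_neg, RCLike.star_def,
      Complex.conj_ofReal]
    abel
  have h1 : star a * ι (ip k k) * a ≤ (c : ℂ) • (star a * a) := by
    have := CStarAlgebra.star_left_conjugate_le_norm_smul (a := a) (b := ι (ip k k))
      (IsSelfAdjoint.of_nonneg (h.nonneg k))
    simpa [hc] using this
  have h2 : (c : ℂ) • (star a * a) ≤ (c : ℂ) • (c : ℂ) • ι (ip l l) := by
    rw [e] at key
    rw [← sub_nonneg]
    refine key.trans ?_
    rw [← sub_nonneg] at h1 ⊢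
    convert h1 using 1
    abel
  have h3 : star a * a ≤ c • ι (ip l l) := by
    have h2' : c • (star a * a) ≤ c • c • ι (ip l l) := by simpa using h2
    rwa [smul_le_smul_iff_of_pos_left hpos] at h2'
  calc ‖a‖ ^ 2 = ‖star a * a‖ := by rw [CStarRing.norm_star_mul_self, sq]
    _ ≤ ‖c • ι (ip l l)‖ := CStarAlgebra.norm_le_norm_of_nonneg_of_le (star_mul_self_nonneg a) h3
    _ = c * ‖ι (ip l l)‖ := by rw [norm_smul, Real.norm_of_nonneg hpos.le]

lemma norm_ip_le (k l : V) : ‖ι (ip k l)‖ ≤ √‖ι (ip k k)‖ * √‖ι (ip l l)‖ := by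
  rw [← Real.sqrt_mul (norm_nonneg _)]
  exact Real.le_sqrt_of_sq_le (h.norm_ip_sq_le hι k l)

lemma normedSpaceCore :
    letI : Norm V := ⟨fun k => √‖ι (ip k k)‖⟩
    NormedSpace.Core ℂ V :=
  letI : Norm V := ⟨fun k => √‖ι (ip k k)‖⟩
  { norm_nonneg := fun k => Real.sqrt_nonneg _
    norm_smul := fun c k => by
      change √‖ι (ip (c • k) (c • k))‖ = ‖c‖ * √‖ι (ip k k)‖
      rw [h.ip_smul, map_smul, h.ι_smul_left hι, norm_smul, norm_smul, norm_star, ← mul_assoc,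
        Real.sqrt_mul (by positivity), Real.sqrt_mul_self (norm_nonneg c)]
    norm_triangle := fun k l => by
      change √‖ι (ip (k + l) (k + l))‖ ≤ √‖ι (ip k k)‖ + √‖ι (ip l l)‖
      refine Real.sqrt_le_iff.2 ⟨by positivity, ?_⟩
      rw [h.ip_add, map_add, h.ι_add_left hι, h.ι_add_left hι]
      have h1 := norm_add_le (ι (ip k k) + ι (ip l k)) (ι (ip k l) + ι (ip l l))
      have h2 := norm_add_le (ι (ip k k)) (ι (ip l k))
      have h3 := norm_add_le (ι (ip k l)) (ι (ip l l))
      have h4 := h.norm_ip_le hι k l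
      have h5 := h.norm_ip_le hι l k
      have h6 := Real.sq_sqrt (norm_nonneg (ι (ip k k)))
      have h7 := Real.sq_sqrt (norm_nonneg (ι (ip l l)))
      nlinarith
    norm_eq_zero_iff := fun k => by
      change √‖ι (ip k k)‖ = 0 ↔ k = 0
      refine ⟨fun h0 => h.eq_zero_of_norm hι k ((Real.sqrt_eq_zero (norm_nonneg _)).1 h0), ?_⟩
      rintro rfl
      simp [h.ip_zero] }

end Algebra

section Completion

open UniformSpace

variable [NormedAddCommGroup V] [NormedSpace ℂ V] {ip : V → V → R} {act : V → R → V}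
  (h : IsPreHilbertModule mul invol ι ip act) (hι : IsDenseStarEmbedding mul invol ι)
  (hn : ∀ k, ‖k‖ = √‖ι (ip k k)‖) [StarOrderedRing A]

include h hι hn

/-- Cauchy-Schwarz bounds the form, which is then extended one variable at a time; the flip between
the two extensions is the reason for the order `Φ l k`. -/
lemma exists_extend_ip : ∃ Φ : Completion V →L[ℂ] Completion V →L⋆[ℂ] A,
    ∀ k l : V, Φ l k = ι (ip k l) := by
  let Φ₀ : V →L⋆[ℂ] V →L[ℂ] A :=
    LinearMap.mkContinuous₂
      (LinearMap.mk₂'ₛₗ (starRingEnd ℂ) (RingHom.id ℂ) (fun k l => ι (ip k l))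
        (h.ι_add_left hι) (h.ι_smul_left hι) (fun k l m => by rw [h.ip_add, map_add])
        (fun c k l => by rw [h.ip_smul, map_smul]; rfl)) 1
      (fun k l => by
        rw [one_mul, hn k, hn l]
        exact h.norm_ip_le hι k l)
  let e : V →L[ℂ] Completion V := Completion.toComplL
  have hd : DenseRange e := Completion.denseRange_coe
  have hu : IsUniformInducing e := Completion.isUniformInducing_coe V
  refine ⟨(Φ₀.extend e).flip.extend e, fun k l => ?_⟩
  have e1 := ContinuousLinearMap.extend_eq (Φ₀.extend e).flip hd hu l
  have e2 := ContinuousLinearMap.extend_eq Φ₀ hd hu k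
  change ((Φ₀.extend e).flip.extend e) (e l) (e k) = _
  rw [e1, ContinuousLinearMap.flip_apply, e2]
  rfl

omit [StarOrderedRing A] in
-- `⟨kf, kf⟩ = f^*⟨k,k⟩f`, whose norm is at most `‖f‖²‖⟨k,k⟩‖`.
lemma norm_act_le (k : V) (f : R) : ‖act k f‖ ≤ ‖k‖ * ‖ι f‖ := by
  rw [hn, hn, h.ι_ip_act hι, h.ι_act_left hι]
  refine Real.sqrt_le_iff.2 ⟨by positivity, ?_⟩
  rw [mul_pow, Real.sq_sqrt (norm_nonneg _)]
  have h1 := norm_mul_le (star (ι f) * ι (ip k k)) (ι f)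
  have h2 := norm_mul_le (star (ι f)) (ι (ip k k))
  rw [norm_star] at h2
  nlinarith [norm_nonneg (ι f), mul_le_mul_of_nonneg_right h2 (norm_nonneg (ι f))]

/-- For fixed `k` the map `f ↦ kf` is bounded for the norm of `A`, hence extends along the dense
range of `ι`. Uniqueness of the extension makes it linear in `k`, and its norm bound lets `k` range
over the completion. -/
lemma exists_extend_act : ∃ Ψ : Completion V →L[ℂ] A →L[ℂ] Completion V,
    ∀ (k : V) (f : R), Ψ k (ι f) = (act k f : V) := by
  let a (k : V) : R →ₗ[ℂ] Completion V :=
    { toFun := fun f => (act k f : V)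
      map_add' := fun f g => by rw [h.act_add, Completion.coe_add]
      map_smul' := fun c f => by rw [h.act_smul, Completion.coe_smul]; rfl }
  have ha : ∀ k f, ‖a k f‖ ≤ ‖k‖ * ‖ι f‖ := fun k f => by
    change ‖((act k f : V) : Completion V)‖ ≤ _
    rw [Completion.norm_coe]
    exact h.norm_act_le hι hn k f
  have he : ∀ k f, (a k).extendOfNorm ι (ι f) = (act k f : V) := fun k f =>
    LinearMap.extendOfNorm_eq hι.dense ⟨_, ha k⟩ f
  have hadd : ∀ k l, (a (k + l)).extendOfNorm ι = (a k).extendOfNorm ι + (a l).extendOfNorm ι := by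
    intro k l
    refine LinearMap.extendOfNorm_unique hι.dense ‖k + l‖ (ha _) _ (LinearMap.ext fun f => ?_)
    change (a k).extendOfNorm ι (ι f) + (a l).extendOfNorm ι (ι f) = (act (k + l) f : V)
    rw [he, he, h.add_act, Completion.coe_add]
  have hsmul : ∀ (c : ℂ) k, (a (c • k)).extendOfNorm ι = c • (a k).extendOfNorm ι := by
    intro c k
    refine LinearMap.extendOfNorm_unique hι.dense ‖c • k‖ (ha _) _ (LinearMap.ext fun f => ?_)
    change c • (a k).extendOfNorm ι (ι f) = (act (c • k) f : V)
    rw [he, h.smul_act, Completion.coe_smul]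
  let Ψ₀ : V →L[ℂ] A →L[ℂ] Completion V :=
    LinearMap.mkContinuous
      { toFun := fun k => (a k).extendOfNorm ι
        map_add' := hadd
        map_smul' := hsmul } 1
      (fun k => by
        rw [one_mul]
        exact LinearMap.opNorm_extendOfNorm_le hι.dense (norm_nonneg k) (ha k))
  let e : V →L[ℂ] Completion V := Completion.toComplL
  refine ⟨Ψ₀.extend e, fun k f => ?_⟩
  have e1 := ContinuousLinearMap.extend_eq Ψ₀ (e := e)
    Completion.denseRange_coe (Completion.isUniformInducing_coe V) k
  change (Ψ₀.extend e) (e k) (ι f) = _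
  rw [e1]
  exact he k f

lemma exists_isHilbertModule_completion :
    ∃ (ip' : Completion V → Completion V → A) (act' : Completion V → A → Completion V),
      IsHilbertModule ip' act' ∧
      (∀ k l : V, ip' (k : Completion V) (l : Completion V) = ι (ip k l)) ∧
      ∀ (k : V) (f : R), act' (k : Completion V) (ι f) = ((act k f : V) : Completion V) := by
  obtain ⟨Φ, hΦ⟩ := h.exists_extend_ip hι hn
  obtain ⟨Ψ, hΨ⟩ := h.exists_extend_act hι hn
  -- Joint continuity makes the identities and the positivity of the form closed conditions, to be
  -- checked on `V` and on the range of `ι` only.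
  have hΦc : Continuous fun z : Completion V × Completion V => Φ z.1 z.2 := by
    refine continuous_iff_continuousAt.2 fun z => tendsto_iff_norm_sub_tendsto_zero.2 ?_
    have hlim : Filter.Tendsto (fun w : Completion V × Completion V =>
        ‖Φ‖ * ‖w.1 - z.1‖ * ‖w.2‖ + ‖Φ z.1‖ * ‖w.2 - z.2‖) (𝓝 z) (𝓝 0) := by
      have : Continuous fun w : Completion V × Completion V =>
        ‖Φ‖ * ‖w.1 - z.1‖ * ‖w.2‖ + ‖Φ z.1‖ * ‖w.2 - z.2‖ := by fun_prop
      simpa using this.tendsto z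
    refine squeeze_zero (fun _ => norm_nonneg _) (fun w => ?_) hlim
    have e : Φ w.1 w.2 - Φ z.1 z.2 = Φ (w.1 - z.1) w.2 + Φ z.1 (w.2 - z.2) := by simp
    rw [e]
    exact norm_add_le_of_le (Φ.le_opNorm₂ _ _) ((Φ z.1).le_opNorm _)
  have hΦ' : ∀ {Y : Type _} [TopologicalSpace Y] {f g : Y → Completion V}, Continuous f →
      Continuous g → Continuous fun y => Φ (f y) (g y) := fun hf hg =>
    hΦc.comp (hf.prodMk hg)
  have hnorm : ∀ x, ‖x‖ = √‖Φ x x‖ := by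
    intro x
    induction x using Completion.induction_on with
    | hp => exact isClosed_eq (by fun_prop) (hΦ' continuous_id continuous_id).norm.sqrt
    | ih k => rw [Completion.norm_coe, hn, hΦ]
  refine ⟨fun x y => Φ y x, fun x a => Ψ x a, ⟨⟨?_, ?_, ?_, ?_, ?_, ?_, ?_, ?_, ?_, ?_, ?_⟩,
    hnorm, inferInstance⟩, hΦ, hΨ⟩
  · intro k l f; simp
  · intro k f g; simp
  · intro c k f; simp
  · intro c k f; simp
  · intro k a b
    induction k using Completion.induction_on with
    | hp => exact isClosed_eq (by fun_prop) (by fun_prop)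
    | ih k =>
    induction a using hι.dense.induction_on with
    | hp => exact isClosed_eq (by fun_prop) (by fun_prop)
    | ih f =>
    induction b using hι.dense.induction_on with
    | hp => exact isClosed_eq (by fun_prop) (by fun_prop)
    | ih g => rw [← hι.map_mul, hΨ, hΨ, hΨ, h.act_mul]
  · intro k l m; simp
  · intro c k l; simp
  · intro k l a
    induction k, l using Completion.induction_on₂ with
    | hp =>
      exact isClosed_eq (hΦ' (by fun_prop) (by fun_prop))
        ((hΦ' (by fun_prop) (by fun_prop)).mul continuous_const)
    | ih k l =>
    induction a using hι.dense.induction_on with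
    | hp => exact isClosed_eq (by fun_prop) (by fun_prop)
    | ih f => rw [hΨ, hΦ, hΦ, h.ι_ip_act hι]
  · intro k l
    induction k, l using Completion.induction_on₂ with
    | hp =>
      exact isClosed_eq (hΦ' (by fun_prop) (by fun_prop)).star (hΦ' (by fun_prop) (by fun_prop))
    | ih k l => rw [hΦ, hΦ, h.star_ip hι]
  · intro k
    induction k using Completion.induction_on with
    | hp => exact CStarAlgebra.isClosed_nonneg.preimage (hΦ' continuous_id continuous_id)
    | ih k => simpa [hΦ] using h.nonneg k
  -- Definiteness is not a closed condition; it comes from the norm formula.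
  · intro k hk
    rw [← norm_eq_zero, hnorm, hk]
    simp

end Completion

theorem completionIsHilbertModule [StarOrderedRing A] [AddCommGroup V] [Module ℂ V]
    {ip : V → V → R} {act : V → R → V} (h : IsPreHilbertModule mul invol ι ip act)
    (hι : IsDenseStarEmbedding mul invol ι) : CompletionIsHilbertModule ι ip act := by
  let : Norm V := ⟨fun k => √‖ι (ip k k)‖⟩
  have hN : NormedSpace.Core ℂ V := h.normedSpaceCore hι
  let : NormedAddCommGroup V := NormedAddCommGroup.ofCore hN
  let : NormedSpace ℂ V := NormedSpace.ofCore hN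
  exact ⟨hN, exists_isHilbertModule_completion (V := V) h hι fun _ => rfl⟩

end IsPreHilbertModule

end Modules

/-! ### Integration of functions that are continuous on a closed set carrying the measure -/

section ClosedCarrier

variable {Y : Type*} [TopologicalSpace Y] [T2Space Y] [MeasurableSpace Y] [BorelSpace Y]
  {N : Type*} [NormedAddCommGroup N]

/-- Products `t⁻¹x` have arbitrary values off the composable pairs, so the integrands below are
continuous only along a closed fibre. This suffices because the measure does not charge the
complement. -/
lemma aestronglyMeasurable_of_continuousOn [SecondCountableTopology Y] {μ : Measure Y} {F : Set Y}
    (hF : IsClosed F) (hμ : μ Fᶜ = 0) {f : Y → N} (hf : ContinuousOn f F) :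
    AEStronglyMeasurable f μ := by
  have h : μ.restrict F = μ := Measure.restrict_eq_self_of_ae_mem (mem_ae_iff.2 hμ)
  rw [← h]
  exact hf.aestronglyMeasurable hF.measurableSet

lemma integrable_of_continuousOn {μ : Measure Y} [IsFiniteMeasureOnCompacts μ]
    {F : Set Y} (hF : IsClosed F) (hμ : μ Fᶜ = 0) {f : Y → N} (hf : ContinuousOn f F) {K : Set Y}
    (hK : IsCompact K) (h0 : ∀ y ∈ F, y ∉ K → f y = 0) : Integrable f μ := by
  have h : IntegrableOn f (K ∩ F) μ :=
    (hf.mono inter_subset_right).integrableOn_compact (hK.inter_right hF)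
  refine h.integrable_of_ae_notMem_eq_zero ?_
  filter_upwards [mem_ae_iff.2 hμ] with y hy hn
  exact h0 y hy fun hk => hn ⟨hk, hy⟩

section Prod

variable [SecondCountableTopology Y] [LocallyCompactSpace Y]
  {Z : Type*} [TopologicalSpace Z] [T2Space Z] [MeasurableSpace Z] [BorelSpace Z]
  [SecondCountableTopology Z] [LocallyCompactSpace Z]
  {μ : Measure Y} {ν : Measure Z} [IsFiniteMeasureOnCompacts μ] [IsFiniteMeasureOnCompacts ν]
  {F : Set Y} {F' : Set Z} (hF : IsClosed F) (hF' : IsClosed F') (hμ : μ Fᶜ = 0)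
  (hν : ν F'ᶜ = 0) {f : Y → Z → N} (hf : ContinuousOn (fun w : Y × Z => f w.1 w.2) (F ×ˢ F'))
  {K : Set Y} {K' : Set Z} (hK : IsCompact K) (hK' : IsCompact K')
  (h0 : ∀ y ∈ F, ∀ z ∈ F', f y z ≠ 0 → y ∈ K ∧ z ∈ K')

include hF hF' hμ hν hf hK hK' h0

lemma integrable_prod_of_continuousOn : Integrable (Function.uncurry f) (μ.prod ν) := by
  refine integrable_of_continuousOn (hF.prod hF') ?_ hf (hK.prod hK') ?_
  · refine mem_ae_iff.1 ?_
    have h1 : ∀ᵐ w ∂(μ.prod ν), w.1 ∈ F := Measure.quasiMeasurePreserving_fst.ae (mem_ae_iff.2 hμ)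
    have h2 : ∀ᵐ w ∂(μ.prod ν), w.2 ∈ F' := Measure.quasiMeasurePreserving_snd.ae (mem_ae_iff.2 hν)
    filter_upwards [h1, h2] with w a b using ⟨a, b⟩
  · rintro ⟨y, z⟩ ⟨hy, hz⟩ hn
    by_contra hc
    exact hn (h0 y hy z hz hc)

lemma integral_integral_swap_of_continuousOn [NormedSpace ℝ N] :
    ∫ y, ∫ z, f y z ∂ν ∂μ = ∫ z, ∫ y, f y z ∂μ ∂ν :=
  integral_integral_swap (integrable_prod_of_continuousOn hF hF' hμ hν hf hK hK' h0)

end Prod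

end ClosedCarrier

/-! ### Haar systems -/

namespace SmoothHaarSystem

variable {G : Type uG} {B : Type uB} [TopologicalSpace G] [TopologicalSpace B] [T2Space B]
  {𝒢 : TopGroupoid G B} {X : Type uX} [TopologicalSpace X] [T2Space X]
  [MeasurableSpace X] [BorelSpace X] {p : X → B} {α : GroupoidAction 𝒢 p} {k : ℕ}
  {𝔛 : ContFamily p k} (μ : SmoothHaarSystem α 𝔛)
  {N : Type*} [NormedAddCommGroup N]

instance (u : B) : IsFiniteMeasureOnCompacts (μ.meas u) := μ.finite_on_compacts u

include 𝔛 in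
lemma _root_.CFG.ContFamily.isClosed_fibre (u : B) : IsClosed (p ⁻¹' {u}) :=
  isClosed_singleton.preimage 𝔛.continuous_proj

lemma ae_mem (u : B) : ∀ᵐ x ∂(μ.meas u), p x = u := mem_ae_iff.2 (μ.concentrated u)

lemma integrable {u : B} {f : X → N} (hf : ContinuousOn f (p ⁻¹' {u})) {K : Set X}
    (hK : IsCompact K) (h0 : ∀ x, p x = u → x ∉ K → f x = 0) : Integrable f (μ.meas u) :=
  integrable_of_continuousOn (𝔛.isClosed_fibre u) (μ.concentrated u) hf hK h0

/-- The set where `f` does not vanish is relatively open in the fibre, so it would have positive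
measure if it were nonempty. -/
lemma eq_zero_of_ae {u : B} {f : X → N} (hf : ContinuousOn f (p ⁻¹' {u}))
    (h : ∀ᵐ x ∂(μ.meas u), f x = 0) (x : X) (hx : p x = u) : f x = 0 := by
  by_contra hne
  have h1 : ∀ᶠ y in 𝓝[p ⁻¹' {u}] x, f y ≠ 0 := (hf x hx).eventually_ne hne
  obtain ⟨V, hV, hxV, hVs⟩ := mem_nhdsWithin.1 h1
  have hpos := μ.full_support u V hV ⟨x, hxV, hx⟩
  refine hpos.ne' (measure_mono_null (t := {y | ¬ f y = 0} ∪ (p ⁻¹' {u})ᶜ) ?_ ?_)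
  · intro y hy
    by_cases hyu : p y = u
    · exact Or.inl (hVs ⟨hy, hyu⟩)
    · exact Or.inr hyu
  · exact measure_union_null h (μ.concentrated u)

variable [LocallyCompactSpace X] [SecondCountableTopology X] [NormedSpace ℝ N]

/-- In the chart the integral is `∫ ρ(u, w) f(φ⁻¹(u, w)) dw`, with an integrand that is jointly
continuous and compactly supported once extended by zero. -/
lemma continuous_integral_of_tsupport_subset {φ : OpenPartialHomeomorph X (B × Coord k)}
    (hφ : φ ∈ 𝔛.atlas) {f : X → N} (hf : Continuous f) (hc : HasCompactSupport f)
    (hs : tsupport f ⊆ φ.source) : Continuous fun u => ∫ x, f x ∂(μ.meas u) := by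
  classical
  obtain ⟨ρ, hρ, hρ0, hmap⟩ := μ.smooth φ hφ
  have hρc : ContinuousOn ρ φ.target := by
    -- The derivative of order zero is the function itself.
    have := hρ.2 0
    exact ((continuousMultilinearCurryFin0 ℝ (Coord k) ℝ).continuous.comp_continuousOn this).congr
      fun z hz => by simp
  set K' : Set (B × Coord k) := φ '' tsupport f with hK'
  have hK'c : IsCompact K' := hc.isCompact.image_of_continuousOn (φ.continuousOn.mono hs)
  let H : B × Coord k → N := fun z => if z ∈ φ.target then ρ z • f (φ.symm z) else 0
  have hH0 : ∀ z, z ∉ K' → H z = 0 := by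
    intro z hz
    by_cases hzt : z ∈ φ.target
    · have : f (φ.symm z) = 0 := by
        by_contra hne
        exact hz ⟨φ.symm z, subset_tsupport f hne, φ.right_inv hzt⟩
      simp [H, this]
    · simp [H, hzt]
  have hHc : Continuous H := by
    refine continuous_iff_continuousAt.2 fun z => ?_
    by_cases hz : z ∈ φ.target
    · have h1 : ContinuousOn (fun z => ρ z • f (φ.symm z)) φ.target :=
        hρc.smul (hf.comp_continuousOn φ.continuousOn_symm)
      refine (h1.continuousAt (φ.open_target.mem_nhds hz)).congr ?_
      filter_upwards [φ.open_target.mem_nhds hz] with w hw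
      simp [H, hw]
    -- Off the chart's image the extension is zero nearby, because the compact set `K'` is closed
    -- and misses the point.
    · have hzK : z ∉ K' := by
        rintro ⟨x, hx, rfl⟩
        exact hz (φ.map_source (hs hx))
      refine (continuousAt_const (y := (0 : N))).congr ?_
      filter_upwards [hK'c.isClosed.isOpen_compl.mem_nhds hzK] with w hw
      exact (hH0 w hw).symm
  have hcont : Continuous fun u => ∫ w, H (u, w) := by
    rw [← continuousOn_univ]
    refine continuousOn_integral_of_compact_support (k := Prod.snd '' K')
      (hK'c.image continuous_snd) (f := fun u w => H (u, w)) hHc.continuousOn ?_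
    intro u w _ hw
    exact hH0 _ fun h => hw ⟨_, h, rfl⟩
  convert hcont using 1
  ext u
  set S : Set (Coord k) := {w | (u, w) ∈ φ.target} with hS
  have hSo : IsOpen S := φ.open_target.preimage (by fun_prop)
  have hmeas : AEMeasurable (fun x => (φ x).2) ((μ.meas u).restrict φ.source) :=
    (continuous_snd.comp_continuousOn φ.continuousOn).aemeasurable φ.open_source.measurableSet
  have hSc : ContinuousOn (fun w : Coord k => f (φ.symm (u, w))) S :=
    hf.comp_continuousOn (φ.continuousOn_symm.comp (by fun_prop) fun w hw => hw)
  have hρS : ContinuousOn (fun w : Coord k => ρ (u, w)) S :=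
    hρc.comp (by fun_prop) fun w hw => hw
  have h1 : ∫ x, f x ∂(μ.meas u) = ∫ x in φ.source, f x ∂(μ.meas u) :=
    (setIntegral_eq_integral_of_forall_compl_eq_zero fun x hx =>
      image_eq_zero_of_notMem_tsupport fun h => hx (hs h)).symm
  have h2 : ∫ x in φ.source, f x ∂(μ.meas u)
      = ∫ x in φ.source, f (φ.symm (u, (φ x).2)) ∂(μ.meas u) := by
    refine integral_congr_ae ?_
    filter_upwards [ae_restrict_of_ae (μ.ae_mem u),
      ae_restrict_mem φ.open_source.measurableSet] with x hx hxs
    have : (u, (φ x).2) = φ x := Prod.ext (by rw [𝔛.fst_chart φ hφ x hxs, hx]) rfl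
    rw [this, φ.left_inv hxs]
  rw [h1, h2, ← integral_map (f := fun w => f (φ.symm (u, w))) hmeas, (hmap u).1,
    integral_withDensity_eq_integral_toReal_smul₀]
  · rw [← integral_indicator hSo.measurableSet]
    refine integral_congr_ae (ae_of_all _ fun w => ?_)
    by_cases hw : w ∈ S
    · have hw' : (u, w) ∈ φ.target := hw
      simp [hw, H, hw', ENNReal.toReal_ofReal (hρ0 _ hw')]
    · have hw' : (u, w) ∉ φ.target := hw
      simp [hw, H, hw']
  · exact (hρS.aemeasurable hSo.measurableSet).ennreal_ofReal
  · exact ae_of_all _ fun w => ENNReal.ofReal_lt_top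
  · rw [(hmap u).1]
    exact (hSc.aestronglyMeasurable hSo.measurableSet).mono_ac
      (withDensity_absolutelyContinuous _ _)

/-- A partition of unity on the compact support reduces to functions supported in one chart. -/
lemma continuous_integral {f : X → N} (hf : Continuous f) (hc : HasCompactSupport f) :
    Continuous fun u => ∫ x, f x ∂(μ.meas u) := by
  choose φ hφ hxφ using 𝔛.cover
  obtain ⟨t, ht⟩ := hc.isCompact.elim_finite_subcover (fun x => (φ x).source)
    (fun x => (φ x).open_source) fun x _ => mem_iUnion.2 ⟨x, hxφ x⟩
  let e := t.equivFin
  obtain ⟨ψ, hψs, hψ1, -, hψc⟩ := exists_continuous_sum_one_of_isOpen_isCompact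
    (s := fun i => (φ (e.symm i)).source) (fun i => (φ _).open_source) hc.isCompact (by
      intro x hx
      obtain ⟨y, hy, hxy⟩ := mem_iUnion₂.1 (ht hx)
      exact mem_iUnion.2 ⟨e ⟨y, hy⟩, by simpa using hxy⟩)
  have hsum : ∀ x, f x = ∑ i, ψ i x • f x := by
    intro x
    by_cases hx : x ∈ tsupport f
    · have := hψ1 hx
      simp only [Finset.sum_apply, Pi.one_apply] at this
      rw [← Finset.sum_smul, this, one_smul]
    · simp [image_eq_zero_of_notMem_tsupport hx]
  have hi : ∀ i, Continuous fun x => ψ i x • f x := fun i => (ψ i).continuous.smul hf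
  have hic : ∀ i, HasCompactSupport fun x => ψ i x • f x := fun i => (hψc i).smul_right
  have : (fun u => ∫ x, f x ∂(μ.meas u)) = fun u => ∑ i, ∫ x, ψ i x • f x ∂(μ.meas u) := by
    ext u
    rw [← integral_finsetSum _ fun i _ => (hi i).integrable_of_hasCompactSupport (hic i)]
    exact integral_congr_ae (ae_of_all _ hsum)
  rw [this]
  refine continuous_finsetSum _ fun i _ => μ.continuous_integral_of_tsupport_subset
    (hφ (e.symm i)) (hi i) (hic i) ?_
  exact (tsupport_smul_subset_left _ _).trans (hψs i)

/-- Near `t₀`, compare `F t` with one function `g` on all of `X`: a Tietze extension of `F t₀` from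
its closed fibre, cut off by `χ`. The integrals of `g` vary continuously, and `F t - g` is uniformly
small on the fibre of `q t` as `t → t₀`. -/
theorem continuous_integral_fibre [TietzeExtension.{uX} N] {T : Type*} [TopologicalSpace T]
    {q : T → B} (hq : Continuous q) {F : T → X → N}
    (hF : ContinuousOn (fun z : T × X => F z.1 z.2) {z | q z.1 = p z.2}) {K : Set X}
    (hK : IsCompact K) (h0 : ∀ t x, q t = p x → x ∉ K → F t x = 0) :
    Continuous fun t => ∫ x, F t x ∂(μ.meas (q t)) := by
  refine continuous_iff_continuousAt.2 fun t₀ => ?_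
  have hFt : ∀ t, ContinuousOn (F t) (p ⁻¹' {q t}) := fun t =>
    hF.comp (f := fun x => (t, x)) (by fun_prop) fun x hx => Eq.symm hx
  obtain ⟨χ, hχ1, -, hχc, -⟩ := exists_continuous_one_zero_of_isCompact hK isClosed_empty
    (disjoint_empty K)
  -- The integral of this second cutoff, equal to one on the support of `χ`, controls the mass of
  -- that support for all nearby measures at once.
  obtain ⟨χ', hχ'1, -, hχ'c, hχ'0⟩ := exists_continuous_one_zero_of_isCompact hχc.isCompact
    isClosed_empty (disjoint_empty _)
  obtain ⟨f, hf⟩ := ContinuousMap.exists_restrict_eq (𝔛.isClosed_fibre (q t₀))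
    ⟨_, (hFt t₀).domRestrict⟩
  have hf' : ∀ x, p x = q t₀ → f x = F t₀ x := fun x hx =>
    DFunLike.congr_fun hf (⟨x, hx⟩ : p ⁻¹' {q t₀})
  set g : X → N := fun x => χ x • f x with hg
  have hgc : Continuous g := χ.continuous.smul f.continuous
  have hgs : HasCompactSupport g := hχc.smul_right
  have hKL : K ⊆ tsupport χ := fun x hx => subset_tsupport _ (by
    rw [Function.mem_support, hχ1 hx]; exact one_ne_zero)
  have hgF : ∀ x, p x = q t₀ → g x = F t₀ x := by
    intro x hx
    by_cases hxK : x ∈ K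
    · simp [hg, hχ1 hxK, hf' x hx]
    · simp [hg, hf' x hx, h0 t₀ x hx.symm hxK]
  have hJ : Continuous fun t => ∫ x, g x ∂(μ.meas (q t)) :=
    (μ.continuous_integral hgc hgs).comp hq
  have hM : Continuous fun t => ∫ x, χ' x ∂(μ.meas (q t)) :=
    (μ.continuous_integral χ'.continuous hχ'c).comp hq
  -- Tube lemma: around a point of the fibre over `q t₀` the difference is small by continuity;
  -- around a point off that fibre, nearby pairs fail `q t = p x` and the condition is void.
  have key : ∀ ε > 0, ∀ᶠ t in 𝓝 t₀, ∀ x ∈ tsupport χ, q t = p x → ‖F t x - g x‖ < ε := by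
    intro ε hε
    refine hχc.isCompact.eventually_forall_of_forall_eventually fun x _ => ?_
    by_cases hx : q t₀ = p x
    · have h1 : ContinuousWithinAt (fun z : T × X => ‖F z.1 z.2 - g z.2‖)
          {z | q z.1 = p z.2} (t₀, x) :=
        ((hF (t₀, x) hx).sub (hgc.comp continuous_snd).continuousWithinAt).norm
      have h2 : ‖F t₀ x - g x‖ < ε := by rwa [hgF x hx.symm, sub_self, norm_zero]
      exact eventually_nhdsWithin_iff.1 (h1.eventually_lt_const h2)
    · have h1 : ∀ᶠ z : T × X in 𝓝 (t₀, x), q z.1 ≠ p z.2 :=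
        (isOpen_ne_fun (hq.comp continuous_fst)
          (𝔛.continuous_proj.comp continuous_snd)).mem_nhds hx
      filter_upwards [h1] with z hz hz' using absurd hz' hz
  have hbound : ∀ ε > 0, ∀ᶠ t in 𝓝 t₀,
      ‖∫ x, F t x ∂(μ.meas (q t)) - ∫ x, g x ∂(μ.meas (q t))‖
        ≤ ε * ∫ x, χ' x ∂(μ.meas (q t)) := by
    intro ε hε
    filter_upwards [key ε hε] with t ht
    rw [← integral_sub (μ.integrable (hFt t) hK fun x hx => h0 t x hx.symm)
      (hgc.integrable_of_hasCompactSupport hgs), ← integral_const_mul]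
    refine norm_integral_le_of_norm_le
      ((χ'.continuous.integrable_of_hasCompactSupport hχ'c).const_mul ε) ?_
    filter_upwards [μ.ae_mem (q t)] with x hx
    by_cases hxL : x ∈ tsupport χ
    · rw [hχ'1 hxL]
      simpa using (ht x hxL hx.symm).le
    · rw [h0 t x hx.symm fun h => hxL (hKL h), hg]
      simp only [image_eq_zero_of_notMem_tsupport hxL, zero_smul, sub_zero, norm_zero]
      exact mul_nonneg hε.le (hχ'0 x).1
  have hI₀ : ∫ x, F t₀ x ∂(μ.meas (q t₀)) = ∫ x, g x ∂(μ.meas (q t₀)) := by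
    refine integral_congr_ae ?_
    filter_upwards [μ.ae_mem (q t₀)] with x hx using (hgF x hx).symm
  have hdiff : Filter.Tendsto
      (fun t => ∫ x, F t x ∂(μ.meas (q t)) - ∫ x, g x ∂(μ.meas (q t))) (𝓝 t₀) (𝓝 0) := by
    set M := ∫ x, χ' x ∂(μ.meas (q t₀)) with hMdef
    have hM0 : 0 ≤ M := integral_nonneg fun x => (hχ'0 x).1
    rw [Metric.tendsto_nhds]
    intro ε hε
    -- Nearby masses stay below `M + 1`, and `M + 2` is positive and strictly larger.
    filter_upwards [hbound (ε / (M + 2)) (by positivity),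
      (hM.tendsto t₀).eventually_lt_const (lt_add_one M)] with t h1 h2
    rw [dist_zero_right]
    refine h1.trans_lt ?_
    rw [div_mul_eq_mul_div, div_lt_iff₀ (by positivity)]
    exact mul_lt_mul_of_pos_left (by linarith) hε
  have := hdiff.add (hJ.tendsto t₀)
  rw [zero_add] at this
  rw [← hI₀] at this
  exact this.congr fun t => by abel

lemma _root_.CFG.GroupoidAction.continuousOn_smul_left (α : GroupoidAction 𝒢 p) (g : G) :
    ContinuousOn (α.smul g) (p ⁻¹' {𝒢.s g}) :=
  α.continuousOn_smul.comp (f := fun x => (g, x)) (by fun_prop) fun _ hx => Eq.symm hx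

lemma aemeasurable_smul (g : G) : AEMeasurable (α.smul g) (μ.meas (𝒢.s g)) := by
  have h : (μ.meas (𝒢.s g)).restrict (p ⁻¹' {𝒢.s g}) = μ.meas (𝒢.s g) :=
    Measure.restrict_eq_self_of_ae_mem (μ.ae_mem _)
  rw [← h]
  exact (α.continuousOn_smul_left g).aemeasurable (𝔛.isClosed_fibre _).measurableSet

/-- Invariance is given on `C_c` test functions only. It passes to measures because integrals of
such functions determine a measure finite on compact sets; the image measure is one, since the part
over a compact `K` lies in the compact set `g⁻¹(K ∩ X^{r(g)})`. -/
theorem map_smul (g : G) : (μ.meas (𝒢.s g)).map (α.smul g) = μ.meas (𝒢.r g) := by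
  have : IsFiniteMeasureOnCompacts ((μ.meas (𝒢.s g)).map (α.smul g)) := by
    refine ⟨fun K hK => ?_⟩
    rw [Measure.map_apply_of_aemeasurable (μ.aemeasurable_smul g) hK.measurableSet]
    have hc : IsCompact (α.smul (𝒢.inv g) '' (K ∩ p ⁻¹' {𝒢.r g})) := by
      refine (hK.inter_right (𝔛.isClosed_fibre _)).image_of_continuousOn
        ((α.continuousOn_smul_left (𝒢.inv g)).mono ?_)
      rw [𝒢.s_inv]
      exact inter_subset_right
    refine lt_of_le_of_lt (measure_mono_ae ?_) hc.measure_lt_top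
    filter_upwards [μ.ae_mem (𝒢.s g)] with x hx hxK
    exact ⟨α.smul g x, ⟨hxK, α.p_smul g x hx.symm⟩, α.inv_smul_smul g x hx.symm⟩
  let := TopologicalSpace.pseudoMetrizableSpacePseudoMetric X
  refine Measure.ext_of_integral_eq_on_compactlySupported fun f => ?_
  rw [integral_map (f := fun x => f x) (μ.aemeasurable_smul g)
    f.continuous.aestronglyMeasurable]
  let f' : C_c(X, ℂ) := ⟨⟨fun x => (f x : ℂ), by fun_prop⟩, f.hasCompactSupport.comp_left
    (g := fun t : ℝ => (t : ℂ)) Complex.ofReal_zero⟩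
  have := μ.invariant g f'
  change ∫ x, ((f (α.smul g x) : ℝ) : ℂ) ∂_ = ∫ x, ((f x : ℝ) : ℂ) ∂_ at this
  rw [integral_complex_ofReal, integral_complex_ofReal] at this
  exact_mod_cast this

theorem integral_smul (g : G) {u : B} (hu : 𝒢.s g = u) {f : X → N}
    (hf : ContinuousOn f (p ⁻¹' {𝒢.r g})) :
    ∫ x, f (α.smul g x) ∂(μ.meas u) = ∫ x, f x ∂(μ.meas (𝒢.r g)) := by
  subst hu
  rw [← μ.map_smul g, integral_map (μ.aemeasurable_smul g)]
  rw [μ.map_smul g]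
  exact aestronglyMeasurable_of_continuousOn (𝔛.isClosed_fibre _) (μ.concentrated _) hf

end SmoothHaarSystem

/-! ### Calculus in groupoids -/

namespace TopGroupoid

variable {G : Type uG} {B : Type uB} [TopologicalSpace G] [TopologicalSpace B]
  (𝒢 : TopGroupoid G B)

lemma inv_mul_cancel_left (g h : G) (hh : 𝒢.s g = 𝒢.r h) : 𝒢.mul (𝒢.inv g) (𝒢.mul g h) = h :=
  𝒢.leftMul.inv_smul_smul g h hh

lemma mul_inv_cancel_left (g h : G) (hh : 𝒢.r g = 𝒢.r h) : 𝒢.mul g (𝒢.mul (𝒢.inv g) h) = h := by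
  rw [← 𝒢.mul_assoc _ _ _ (𝒢.r_inv g).symm (by rw [𝒢.s_inv, hh]), 𝒢.mul_inv, hh, 𝒢.unit_mul]

lemma inv_inv (g : G) : 𝒢.inv (𝒢.inv g) = g := by
  have h := 𝒢.inv_mul_cancel_left (𝒢.inv g) g (𝒢.s_inv g)
  have h1 := 𝒢.mul_unit (𝒢.inv (𝒢.inv g))
  rw [𝒢.inv_mul] at h
  rw [𝒢.s_inv, 𝒢.r_inv] at h1
  exact h1.symm.trans h

lemma r_inv_mul (g h : G) (hh : 𝒢.r g = 𝒢.r h) : 𝒢.r (𝒢.mul (𝒢.inv g) h) = 𝒢.s g := by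
  rw [𝒢.r_mul _ _ (by rw [𝒢.s_inv, hh]), 𝒢.r_inv]

lemma s_inv_mul (g h : G) (hh : 𝒢.r g = 𝒢.r h) : 𝒢.s (𝒢.mul (𝒢.inv g) h) = 𝒢.s h :=
  𝒢.s_mul _ _ (by rw [𝒢.s_inv, hh])

lemma inv_mul_rev (g h : G) (hh : 𝒢.s g = 𝒢.r h) :
    𝒢.inv (𝒢.mul g h) = 𝒢.mul (𝒢.inv h) (𝒢.inv g) := by
  have h1 := 𝒢.inv_mul_cancel_left (𝒢.mul g h) (𝒢.mul (𝒢.inv h) (𝒢.inv g)) (by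
    rw [𝒢.s_mul _ _ hh, 𝒢.r_mul _ _ (by rw [𝒢.s_inv, 𝒢.r_inv, hh]), 𝒢.r_inv])
  rw [𝒢.mul_assoc _ _ _ hh (by rw [𝒢.r_mul _ _ (by rw [𝒢.s_inv, 𝒢.r_inv, hh]), 𝒢.r_inv]),
    𝒢.mul_inv_cancel_left h _ (by rw [𝒢.r_inv, hh]), 𝒢.mul_inv] at h1
  rw [← h1]
  have h2 := 𝒢.mul_unit (𝒢.inv (𝒢.mul g h))
  rw [𝒢.s_inv, 𝒢.r_mul _ _ hh] at h2
  exact h2.symm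

lemma inv_unit (u : B) : 𝒢.inv (𝒢.unit u) = 𝒢.unit u := by
  have h := 𝒢.mul_unit (𝒢.inv (𝒢.unit u))
  rwa [𝒢.s_inv, 𝒢.r_unit, 𝒢.inv_mul, 𝒢.s_unit, eq_comm] at h

lemma inv_mul_unit (g : G) : 𝒢.mul (𝒢.inv g) (𝒢.unit (𝒢.r g)) = 𝒢.inv g := by
  rw [← 𝒢.s_inv, 𝒢.mul_unit]

include 𝒢 in
-- The unit map is a continuous injection into `G`. A Hausdorff base makes fibres and sets of
-- composable pairs closed.
lemma t2Space_base [T2Space G] : T2Space B :=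
  T2Space.of_injective_continuous (Function.LeftInverse.injective 𝒢.r_unit) 𝒢.continuous_unit

lemma continuousOn_inv_mul :
    ContinuousOn (fun z : G × G => 𝒢.mul (𝒢.inv z.1) z.2) {z | 𝒢.r z.1 = 𝒢.r z.2} := by
  refine 𝒢.continuousOn_mul.comp (f := fun z : G × G => (𝒢.inv z.1, z.2)) ?_ ?_
  · exact ((𝒢.continuous_inv.comp continuous_fst).prodMk continuous_snd).continuousOn
  · intro z hz
    simpa [𝒢.s_inv] using hz

/-- Inversion, as a homeomorphism. -/
def invHomeomorph : G ≃ₜ G where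
  toFun := 𝒢.inv
  invFun := 𝒢.inv
  left_inv := 𝒢.inv_inv
  right_inv := 𝒢.inv_inv
  continuous_toFun := 𝒢.continuous_inv
  continuous_invFun := 𝒢.continuous_inv

end TopGroupoid

/-- The set of all `g x` with `g ∈ K` and `x ∈ L`. -/
def GroupoidAction.smulSet {G : Type uG} {B : Type uB} [TopologicalSpace G] [TopologicalSpace B]
    {𝒢 : TopGroupoid G B} {X : Type uX} [TopologicalSpace X] {p : X → B} (α : GroupoidAction 𝒢 p)
    (K : Set G) (L : Set X) : Set X :=
  (fun z : G × X => α.smul z.1 z.2) '' (K ×ˢ L ∩ {z | 𝒢.s z.1 = p z.2})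

lemma GroupoidAction.isCompact_smulSet {G : Type uG} {B : Type uB} [TopologicalSpace G]
    [TopologicalSpace B] [T2Space B] {𝒢 : TopGroupoid G B} {X : Type uX} [TopologicalSpace X]
    {p : X → B} (α : GroupoidAction 𝒢 p) (hp : Continuous p)
    {K : Set G} {L : Set X} (hK : IsCompact K) (hL : IsCompact L) : IsCompact (α.smulSet K L) :=
  ((hK.prod hL).inter_right (isClosed_eq (𝒢.continuous_s.comp continuous_fst)
    (hp.comp continuous_snd))).image_of_continuousOn (α.continuousOn_smul.mono inter_subset_right)

/-! ### The convolution algebra -/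

namespace SmoothHaarSystem

variable {G : Type uG} {B : Type uB} [TopologicalSpace G] [LocallyCompactSpace G] [T2Space G]
  [SecondCountableTopology G] [MeasurableSpace G] [BorelSpace G] [TopologicalSpace B] [T2Space B]
  {𝒢 : TopGroupoid G B} {m : ℕ} {𝔊 : ContFamily 𝒢.r m} (lam : SmoothHaarSystem 𝒢.leftMul 𝔊)

lemma _root_.CFG.eq_zero_of_notMem_tsupport {Y : Type*} [TopologicalSpace Y] (f : C_c(Y, ℂ)) {y : Y}
    (h : y ∉ tsupport f) : f y = 0 := image_eq_zero_of_notMem_tsupport h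

lemma _root_.CFG.mem_tsupport_of_ne_zero {Y : Type*} [TopologicalSpace Y] (f : C_c(Y, ℂ)) {y : Y}
    (h : f y ≠ 0) : y ∈ tsupport f := subset_tsupport f h

lemma _root_.CFG.isCompact_tsupport {Y : Type*} [TopologicalSpace Y] (f : C_c(Y, ℂ)) :
    IsCompact (tsupport f) := f.hasCompactSupport

variable (𝒢) in
/-- The involution `f^*(x) = conj f(x⁻¹)` of `C_c(G)`. -/
def _root_.CFG.TopGroupoid.invol (f : C_c(G, ℂ)) : C_c(G, ℂ) where
  toFun x := star (f (𝒢.inv x))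
  continuous_toFun := (f.continuous.comp 𝒢.continuous_inv).star
  hasCompactSupport' := HasCompactSupport.intro ((isCompact_tsupport f).image 𝒢.continuous_inv)
    fun x hx => by
      rw [eq_zero_of_notMem_tsupport f fun h => hx ⟨_, h, 𝒢.inv_inv x⟩, star_zero]

lemma _root_.CFG.TopGroupoid.invol_apply (f : C_c(G, ℂ)) (x : G) :
    𝒢.invol f x = star (f (𝒢.inv x)) := rfl

lemma continuousOn_conv_integrand (f g : C_c(G, ℂ)) :
    ContinuousOn (fun z : G × G => f z.2 * g (𝒢.mul (𝒢.inv z.2) z.1)) {z | 𝒢.r z.1 = 𝒢.r z.2} := by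
  refine (f.continuous.comp continuous_snd).continuousOn.mul (g.continuous.comp_continuousOn
    (𝒢.continuousOn_inv_mul.comp (f := fun z : G × G => (z.2, z.1)) (by fun_prop) ?_))
  intro z hz
  exact Eq.symm hz

/-- The convolution product of `C_c(G)`. -/
def mul (f g : C_c(G, ℂ)) : C_c(G, ℂ) where
  toFun := conv 𝒢 lam.meas f g
  continuous_toFun := by
    refine lam.continuous_integral_fibre 𝒢.continuous_r
      (F := fun x t => f t * g (𝒢.mul (𝒢.inv t) x)) (continuousOn_conv_integrand f g)
      (isCompact_tsupport f) fun x t _ ht => ?_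
    rw [eq_zero_of_notMem_tsupport f ht, zero_mul]
  hasCompactSupport' := by
    refine HasCompactSupport.intro (𝒢.leftMul.isCompact_smulSet 𝒢.continuous_r
      (isCompact_tsupport f) (isCompact_tsupport g)) fun x hx => ?_
    refine integral_eq_zero_of_ae ?_
    filter_upwards [lam.ae_mem (𝒢.r x)] with t ht
    by_contra hne
    refine hx ⟨(t, 𝒢.mul (𝒢.inv t) x), ⟨⟨mem_tsupport_of_ne_zero f (left_ne_zero_of_mul hne),
      mem_tsupport_of_ne_zero g (right_ne_zero_of_mul hne)⟩, ?_⟩, 𝒢.mul_inv_cancel_left t x ht⟩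
    exact (𝒢.r_inv_mul t x ht).symm

lemma mul_apply (f g : C_c(G, ℂ)) (x : G) :
    lam.mul f g x = ∫ t, f t * g (𝒢.mul (𝒢.inv t) x) ∂(lam.meas (𝒢.r x)) := rfl

lemma continuousOn_conv_integrand_left (f g : C_c(G, ℂ)) (x : G) :
    ContinuousOn (fun t => f t * g (𝒢.mul (𝒢.inv t) x)) (𝒢.r ⁻¹' {𝒢.r x}) :=
  (continuousOn_conv_integrand f g).comp (f := fun t => (x, t)) (by fun_prop)
    fun _ ht => Eq.symm ht

lemma integrable_conv (f g : C_c(G, ℂ)) (x : G) :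
    Integrable (fun t => f t * g (𝒢.mul (𝒢.inv t) x)) (lam.meas (𝒢.r x)) :=
  lam.integrable (continuousOn_conv_integrand_left f g x) (isCompact_tsupport f) fun t _ ht => by
    rw [eq_zero_of_notMem_tsupport f ht, zero_mul]

/-- The substitution `t = xy`. -/
lemma mul_apply' (f g : C_c(G, ℂ)) (x : G) :
    lam.mul f g x = ∫ y, f (𝒢.mul x y) * g (𝒢.inv y) ∂(lam.meas (𝒢.s x)) := by
  rw [mul_apply, ← lam.integral_smul x rfl (continuousOn_conv_integrand_left f g x)]
  refine integral_congr_ae ?_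
  filter_upwards [lam.ae_mem (𝒢.s x)] with y hy
  change f (𝒢.mul x y) * g (𝒢.mul (𝒢.inv (𝒢.mul x y)) x) = _
  rw [𝒢.inv_mul_rev x y hy.symm, 𝒢.mul_assoc _ _ _ (by rw [𝒢.s_inv, 𝒢.r_inv, hy])
    (𝒢.s_inv x), 𝒢.inv_mul, ← hy, 𝒢.inv_mul_unit]

lemma mul_add (f g h : C_c(G, ℂ)) : lam.mul f (g + h) = lam.mul f g + lam.mul f h := by
  ext x
  rw [CompactlySupportedContinuousMap.add_apply, mul_apply, mul_apply, mul_apply,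
    ← integral_add (lam.integrable_conv f g x) (lam.integrable_conv f h x)]
  simp only [CompactlySupportedContinuousMap.add_apply, _root_.mul_add]

lemma add_mul (f g h : C_c(G, ℂ)) : lam.mul (f + g) h = lam.mul f h + lam.mul g h := by
  ext x
  rw [CompactlySupportedContinuousMap.add_apply, mul_apply, mul_apply, mul_apply,
    ← integral_add (lam.integrable_conv f h x) (lam.integrable_conv g h x)]
  simp only [CompactlySupportedContinuousMap.add_apply, _root_.add_mul]

lemma mul_smul (c : ℂ) (f g : C_c(G, ℂ)) : lam.mul f (c • g) = c • lam.mul f g := by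
  ext x
  rw [CompactlySupportedContinuousMap.smul_apply, mul_apply, mul_apply, smul_eq_mul,
    ← integral_const_mul]
  simp only [CompactlySupportedContinuousMap.smul_apply, smul_eq_mul, mul_left_comm]

lemma smul_mul (c : ℂ) (f g : C_c(G, ℂ)) : lam.mul (c • f) g = c • lam.mul f g := by
  ext x
  rw [CompactlySupportedContinuousMap.smul_apply, mul_apply, mul_apply, smul_eq_mul,
    ← integral_const_mul]
  simp only [CompactlySupportedContinuousMap.smul_apply, smul_eq_mul, _root_.mul_assoc]

/-- The involution exchanges the two integral formulas `mul_apply` and `mul_apply'`. -/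
lemma invol_mul (f g : C_c(G, ℂ)) :
    𝒢.invol (lam.mul f g) = lam.mul (𝒢.invol g) (𝒢.invol f) := by
  ext x
  rw [𝒢.invol_apply, mul_apply, mul_apply', 𝒢.r_inv]
  change starRingEnd ℂ _ = _
  rw [← integral_conj]
  refine integral_congr_ae ?_
  filter_upwards [lam.ae_mem (𝒢.s x)] with y hy
  change star (f y * g _) = _
  rw [𝒢.invol_apply, 𝒢.invol_apply, star_mul', 𝒢.inv_inv, 𝒢.inv_mul_rev _ _ hy.symm, mul_comm]

lemma mul_assoc (f g h : C_c(G, ℂ)) : lam.mul (lam.mul f g) h = lam.mul f (lam.mul g h) := by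
  ext x
  set F : G → G → ℂ := fun t s => f s * g (𝒢.mul (𝒢.inv s) t) * h (𝒢.mul (𝒢.inv t) x) with hF
  have hcl := 𝔊.isClosed_fibre (𝒢.r x)
  have hinv : ContinuousOn (fun t => 𝒢.mul (𝒢.inv t) x) (𝒢.r ⁻¹' {𝒢.r x}) :=
    𝒢.continuousOn_inv_mul.comp (f := fun t => (t, x)) (by fun_prop) fun t ht => ht
  have hFc : ContinuousOn (fun w : G × G => F w.1 w.2)
      ((𝒢.r ⁻¹' {𝒢.r x}) ×ˢ (𝒢.r ⁻¹' {𝒢.r x})) := by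
    refine ((continuousOn_conv_integrand f g).mono ?_).mul
      (h.continuous.comp_continuousOn (hinv.comp continuous_fst.continuousOn fun w hw => hw.1))
    intro w hw
    exact Eq.trans hw.1 (Eq.symm hw.2)
  have hswap := integral_integral_swap_of_continuousOn hcl hcl (lam.concentrated _)
    (lam.concentrated _) hFc (𝒢.leftMul.isCompact_smulSet 𝒢.continuous_r
      (isCompact_tsupport f) (isCompact_tsupport g)) (isCompact_tsupport f) (by
    intro t ht s hs hne
    have h1 : 𝒢.r s = 𝒢.r t := Eq.trans hs (Eq.symm ht)
    have hfs := mem_tsupport_of_ne_zero f (left_ne_zero_of_mul (left_ne_zero_of_mul hne))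
    exact ⟨⟨(s, 𝒢.mul (𝒢.inv s) t), ⟨⟨hfs, mem_tsupport_of_ne_zero g
      (right_ne_zero_of_mul (left_ne_zero_of_mul hne))⟩, (𝒢.r_inv_mul s t h1).symm⟩,
      𝒢.mul_inv_cancel_left s t h1⟩, hfs⟩)
  have hL : lam.mul (lam.mul f g) h x
      = ∫ t, ∫ s, F t s ∂(lam.meas (𝒢.r x)) ∂(lam.meas (𝒢.r x)) := by
    rw [mul_apply]
    refine integral_congr_ae ?_
    filter_upwards [lam.ae_mem (𝒢.r x)] with t ht
    rw [hF, integral_mul_const, mul_apply, ht]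
  have hR : lam.mul f (lam.mul g h) x
      = ∫ s, ∫ t, F t s ∂(lam.meas (𝒢.r x)) ∂(lam.meas (𝒢.r x)) := by
    rw [mul_apply]
    refine integral_congr_ae ?_
    filter_upwards [lam.ae_mem (𝒢.r x)] with s hs
    have hc : ContinuousOn (fun t => F t s) (𝒢.r ⁻¹' {𝒢.r s}) := by
      refine hFc.comp (f := fun t => (t, s)) (by fun_prop) ?_
      intro t ht
      exact ⟨Eq.trans ht hs, hs⟩
    -- The substitution `t ↦ st` turns the inner integral into `(g * h)(s⁻¹x)`.
    rw [← hs, ← lam.integral_smul s rfl hc, mul_apply, 𝒢.r_inv_mul s x hs, ← integral_const_mul]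
    refine integral_congr_ae ?_
    filter_upwards [lam.ae_mem (𝒢.s s)] with t ht
    change f s * (g t * h _) = f s * g (𝒢.mul (𝒢.inv s) (𝒢.mul s t)) *
      h (𝒢.mul (𝒢.inv (𝒢.mul s t)) x)
    rw [𝒢.inv_mul_cancel_left s t ht.symm, 𝒢.inv_mul_rev s t ht.symm,
      𝒢.mul_assoc _ _ _ (by rw [𝒢.s_inv, 𝒢.r_inv, ht]) (by rw [𝒢.s_inv, hs]), _root_.mul_assoc]
  rw [hL, hR, hswap]

end SmoothHaarSystem

/-! ### The regular representations -/

/-- Cauchy-Schwarz for the weight `|f|`, from the nonnegativity of `∫ |f| (|g| - c)²`; it feeds the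
Schur test for convolution operators. -/
lemma norm_integral_mul_sq_le {Y : Type*} [MeasurableSpace Y] {μ : Measure Y} {f g : Y → ℂ} {C : ℝ}
    (hC : 0 < C) (h0 : Integrable f μ) (h1 : Integrable (fun y => f y * g y) μ)
    (h2 : Integrable (fun y => ‖f y‖ * ‖g y‖ ^ 2) μ) (hf : ∫ y, ‖f y‖ ∂μ ≤ C) :
    ‖∫ y, f y * g y ∂μ‖ ^ 2 ≤ C * ∫ y, ‖f y‖ * ‖g y‖ ^ 2 ∂μ := by
  have h1' : Integrable (fun y => ‖f y‖ * ‖g y‖) μ := by simpa using h1.norm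
  set M := ∫ y, ‖f y‖ * ‖g y‖ ∂μ with hM
  set Q := ∫ y, ‖f y‖ * ‖g y‖ ^ 2 ∂μ with hQ
  have hle : ‖∫ y, f y * g y ∂μ‖ ≤ M := by
    simpa using norm_integral_le_integral_norm (μ := μ) fun y => f y * g y
  have key : ∀ c : ℝ, 0 ≤ Q - 2 * c * M + c ^ 2 * ∫ y, ‖f y‖ ∂μ := by
    intro c
    have : 0 ≤ ∫ y, ‖f y‖ * (‖g y‖ - c) ^ 2 ∂μ := integral_nonneg fun y => by positivity
    convert this using 1
    have h3 : Integrable (fun y => ‖f y‖ * ‖g y‖ ^ 2 - 2 * c * (‖f y‖ * ‖g y‖)) μ :=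
      h2.sub (h1'.const_mul _)
    rw [hQ, hM, ← integral_const_mul, ← integral_const_mul, ← integral_sub h2 (h1'.const_mul _),
      ← integral_add h3 (h0.norm.const_mul _)]
    congr 1
    ext y
    ring
  have h3 := key (M / C)
  have h4 : (M / C) ^ 2 * ∫ y, ‖f y‖ ∂μ ≤ (M / C) ^ 2 * C := by gcongr
  have h5 : (M / C) ^ 2 * C = M ^ 2 / C := by field_simp
  have h6 : 2 * (M / C) * M = 2 * (M ^ 2 / C) := by ring
  have h7 : M ^ 2 / C ≤ Q := by linarith
  calc ‖∫ y, f y * g y ∂μ‖ ^ 2 ≤ M ^ 2 := by gcongr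
    _ ≤ C * Q := by rwa [div_le_iff₀' hC] at h7

namespace SmoothHaarSystem

variable {G : Type uG} {B : Type uB} [TopologicalSpace G] [LocallyCompactSpace G] [T2Space G]
  [SecondCountableTopology G] [MeasurableSpace G] [BorelSpace G] [TopologicalSpace B] [T2Space B]
  {𝒢 : TopGroupoid G B} {m : ℕ} {𝔊 : ContFamily 𝒢.r m} (lam : SmoothHaarSystem 𝒢.leftMul 𝔊)

instance (u : B) : IsFiniteMeasureOnCompacts (rightMeas 𝒢 lam.meas u) :=
  Measure.IsFiniteMeasureOnCompacts.map (lam.meas u) 𝒢.invHomeomorph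

instance (u : B) : (rightMeas 𝒢 lam.meas u).Regular :=
  let := TopologicalSpace.pseudoMetrizableSpacePseudoMetric G
  inferInstance

lemma integral_rightMeas (u : B) {N : Type*} [NormedAddCommGroup N] [NormedSpace ℝ N] (f : G → N) :
    ∫ x, f x ∂(rightMeas 𝒢 lam.meas u) = ∫ y, f (𝒢.inv y) ∂(lam.meas u) :=
  𝒢.invHomeomorph.measurableEmbedding.integral_map f

lemma ae_rightMeas (u : B) {P : G → Prop} :
    (∀ᵐ x ∂(rightMeas 𝒢 lam.meas u), P x) ↔ ∀ᵐ y ∂(lam.meas u), P (𝒢.inv y) :=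
  𝒢.invHomeomorph.measurableEmbedding.ae_map_iff

lemma memLp (u : B) (ξ : C_c(G, ℂ)) : MemLp ξ 2 (rightMeas 𝒢 lam.meas u) :=
  ξ.continuous.memLp_of_hasCompactSupport ξ.hasCompactSupport

/-- The class in `L²(G, λ_u)` of a function in `C_c(G)`. -/
def toL2 (u : B) : C_c(G, ℂ) →ₗ[ℂ] Lp ℂ 2 (rightMeas 𝒢 lam.meas u) where
  toFun ξ := (lam.memLp u ξ).toLp ξ
  map_add' ξ η := (lam.memLp u ξ).toLp_add (lam.memLp u η)
  map_smul' c ξ := (lam.memLp u ξ).toLp_const_smul c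

lemma coeFn_toL2 (u : B) (ξ : C_c(G, ℂ)) : lam.toL2 u ξ =ᵐ[rightMeas 𝒢 lam.meas u] ξ :=
  MemLp.coeFn_toLp (lam.memLp u ξ)

lemma eq_toL2 {u : B} {ξ : C_c(G, ℂ)} {v : Lp ℂ 2 (rightMeas 𝒢 lam.meas u)}
    (h : v =ᵐ[rightMeas 𝒢 lam.meas u] ξ) : v = lam.toL2 u ξ :=
  Lp.ext (h.trans (lam.coeFn_toL2 u ξ).symm)

lemma denseRange_toL2 (u : B) : DenseRange (lam.toL2 u) := by
  intro v
  rw [Metric.mem_closure_iff]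
  intro ε hε
  obtain ⟨g, hgs, hgn, hgc, hgm⟩ := (Lp.memLp v).exists_hasCompactSupport_eLpNorm_sub_le
    (ε := ENNReal.ofReal (ε / 2)) ENNReal.ofNat_ne_top (by simpa using hε)
  refine ⟨_, ⟨(⟨⟨g, hgc⟩, hgs⟩ : C_c(G, ℂ)), rfl⟩, ?_⟩
  have h1 : v = (Lp.memLp v).toLp v := (Lp.toLp_coeFn v _).symm
  rw [dist_eq_norm, h1]
  change ‖(Lp.memLp v).toLp v - hgm.toLp g‖ < ε
  rw [← MemLp.toLp_sub, Lp.norm_toLp]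
  calc _ ≤ (ENNReal.ofReal (ε / 2)).toReal := ENNReal.toReal_mono ENNReal.ofReal_ne_top hgn
    _ = ε / 2 := ENNReal.toReal_ofReal (by positivity)
    _ < ε := by linarith

/-- Evaluation at a unit turns adjoints and positivity of operators into computations in `C_c(G)`.
-/
lemma inner_toL2 (u : B) (η ξ : C_c(G, ℂ)) :
    inner ℂ (lam.toL2 u η) (lam.toL2 u ξ) = lam.mul (𝒢.invol η) ξ (𝒢.unit u) := by
  rw [L2.inner_def, mul_apply, 𝒢.r_unit]
  have : ∫ x, inner ℂ (lam.toL2 u η x) (lam.toL2 u ξ x) ∂(rightMeas 𝒢 lam.meas u)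
      = ∫ x, star (η x) * ξ x ∂(rightMeas 𝒢 lam.meas u) := by
    refine integral_congr_ae ?_
    filter_upwards [lam.coeFn_toL2 u η, lam.coeFn_toL2 u ξ] with x h1 h2
    rw [h1, h2, RCLike.inner_apply', RCLike.star_def]
  rw [this, integral_rightMeas]
  refine integral_congr_ae ?_
  filter_upwards [lam.ae_mem u] with y hy
  change _ = star (η (𝒢.inv y)) * ξ _
  rw [← hy, 𝒢.inv_mul_unit]

/-- The integral is continuous in `u` and vanishes off the compact set `r(supp f)`. -/
lemma exists_integral_norm_le (f : C_c(G, ℂ)) : ∃ C > 0, ∀ u, ∫ t, ‖f t‖ ∂(lam.meas u) ≤ C := by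
  have h1 : Continuous fun u => ∫ t, ‖f t‖ ∂(lam.meas u) :=
    lam.continuous_integral f.continuous.norm f.hasCompactSupport.norm
  have h2 : HasCompactSupport fun u => ∫ t, ‖f t‖ ∂(lam.meas u) := by
    refine HasCompactSupport.intro ((isCompact_tsupport f).image 𝒢.continuous_r) fun u hu => ?_
    refine integral_eq_zero_of_ae ?_
    filter_upwards [lam.ae_mem u] with t ht
    rw [eq_zero_of_notMem_tsupport f fun h => hu ⟨t, h, ht⟩]
    simp
  obtain ⟨C, hC⟩ := h1.bounded_above_of_compact_support h2
  exact ⟨max C 1, by positivity, fun u => (le_abs_self _).trans ((hC u).trans (le_max_left _ _))⟩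

lemma continuousOn_mul_right (x : G) : ContinuousOn (fun y => 𝒢.mul x y) (𝒢.r ⁻¹' {𝒢.s x}) :=
  𝒢.leftMul.continuousOn_smul_left x

lemma integral_norm_mul_left_eq (f : C_c(G, ℂ)) (x : G) :
    ∫ y, ‖f (𝒢.mul x y)‖ ∂(lam.meas (𝒢.s x)) = ∫ y, ‖f y‖ ∂(lam.meas (𝒢.r x)) :=
  lam.integral_smul x rfl (f := fun y => ‖f y‖) f.continuous.norm.continuousOn

lemma norm_mul_sq_le {f : C_c(G, ℂ)} {C : ℝ} (hC : 0 < C)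
    (hf : ∀ u, ∫ t, ‖f t‖ ∂(lam.meas u) ≤ C) (ξ : C_c(G, ℂ)) (x : G) :
    ‖lam.mul f ξ x‖ ^ 2 ≤
      C * ∫ y, ‖f (𝒢.mul x y)‖ * ‖ξ (𝒢.inv y)‖ ^ 2 ∂(lam.meas (𝒢.s x)) := by
  have hfx : ContinuousOn (fun y => f (𝒢.mul x y)) (𝒢.r ⁻¹' {𝒢.s x}) :=
    f.continuous.comp_continuousOn (continuousOn_mul_right x)
  have hξ : Continuous fun y => ξ (𝒢.inv y) := ξ.continuous.comp 𝒢.continuous_inv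
  have hK := (isCompact_tsupport ξ).image 𝒢.continuous_inv
  have hξ0 : ∀ y, y ∉ 𝒢.inv '' tsupport ξ → ξ (𝒢.inv y) = 0 := fun y hy =>
    eq_zero_of_notMem_tsupport ξ fun h => hy ⟨_, h, 𝒢.inv_inv y⟩
  rw [mul_apply']
  refine norm_integral_mul_sq_le hC ?_ ?_ ?_ ?_
  · refine lam.integrable hfx ((𝒢.leftMul.isCompact_smulSet 𝒢.continuous_r
      (isCompact_singleton (x := 𝒢.inv x)) (isCompact_tsupport f))) fun y hy hn => ?_
    by_contra hne
    refine hn ⟨(𝒢.inv x, 𝒢.mul x y), ⟨⟨rfl, mem_tsupport_of_ne_zero f hne⟩, ?_⟩,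
      𝒢.inv_mul_cancel_left x y hy.symm⟩
    change 𝒢.s (𝒢.inv x) = _
    rw [𝒢.s_inv, 𝒢.r_mul x y hy.symm]
  · exact lam.integrable (hfx.mul hξ.continuousOn) hK fun y _ hy => by rw [hξ0 y hy, mul_zero]
  · exact lam.integrable (hfx.norm.mul (hξ.norm.pow 2).continuousOn) hK fun y _ hy => by
      simp [hξ0 y hy]
  · rw [integral_norm_mul_left_eq]
    exact hf _

lemma norm_toL2_sq (u : B) (ξ : C_c(G, ℂ)) :
    ‖lam.toL2 u ξ‖ ^ 2 = ∫ y, ‖ξ (𝒢.inv y)‖ ^ 2 ∂(lam.meas u) := by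
  rw [← lam.integral_rightMeas u (fun x => ‖ξ x‖ ^ 2), ← Complex.ofReal_inj,
    ← integral_complex_ofReal]
  have h := inner_self_eq_norm_sq_to_K (𝕜 := ℂ) (lam.toL2 u ξ)
  push_cast at h ⊢
  refine Eq.trans h.symm ?_
  rw [L2.inner_def]
  refine integral_congr_ae ?_
  filter_upwards [lam.coeFn_toL2 u ξ] with x h1
  rw [h1, inner_self_eq_norm_sq_to_K]
  rfl

/-- Schur test: the kernel `|f(y⁻¹z)|` has integral at most `C₁` in `z` and at most `C₂` in `y`, so
the operator norm is at most `√(C₁C₂)`, independently of `u`. -/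
lemma exists_norm_toL2_mul_le (f : C_c(G, ℂ)) :
    ∃ C, 0 ≤ C ∧ ∀ u ξ, ‖lam.toL2 u (lam.mul f ξ)‖ ≤ C * ‖lam.toL2 u ξ‖ := by
  obtain ⟨C₁, hC₁, h1⟩ := lam.exists_integral_norm_le f
  obtain ⟨C₂, hC₂, h2⟩ := lam.exists_integral_norm_le (𝒢.invol f)
  refine ⟨√(C₁ * C₂), by positivity, fun u ξ => ?_⟩
  refine le_of_sq_le_sq ?_ (by positivity)
  rw [mul_pow, Real.sq_sqrt (by positivity), norm_toL2_sq, norm_toL2_sq]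
  set F : G → G → ℝ := fun y z => ‖f (𝒢.mul (𝒢.inv y) z)‖ * ‖ξ (𝒢.inv z)‖ ^ 2 with hF
  have hcl := 𝔊.isClosed_fibre u
  have hξ : Continuous fun y => ‖ξ (𝒢.inv y)‖ ^ 2 :=
    (ξ.continuous.comp 𝒢.continuous_inv).norm.pow 2
  have hK := (isCompact_tsupport ξ).image 𝒢.continuous_inv
  have hξ0 : ∀ y, ξ (𝒢.inv y) ≠ 0 → y ∈ 𝒢.inv '' tsupport ξ := fun y hy =>
    ⟨_, mem_tsupport_of_ne_zero ξ hy, 𝒢.inv_inv y⟩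
  have hFc : ContinuousOn (fun w : G × G => F w.1 w.2)
      ((𝒢.r ⁻¹' {u}) ×ˢ (𝒢.r ⁻¹' {u})) := by
    refine ContinuousOn.mul (f.continuous.comp_continuousOn
      (𝒢.continuousOn_inv_mul.mono ?_)).norm (hξ.comp continuous_snd).continuousOn
    intro w hw
    exact Eq.trans hw.1 (Eq.symm hw.2)
  have hsupp : ∀ y ∈ 𝒢.r ⁻¹' {u}, ∀ z ∈ 𝒢.r ⁻¹' {u}, F y z ≠ 0 →
      y ∈ 𝒢.leftMul.smulSet (𝒢.inv '' tsupport ξ) (𝒢.inv '' tsupport f) ∧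
        z ∈ 𝒢.inv '' tsupport ξ := by
    intro y hy z hz hne
    have hyz : 𝒢.r y = 𝒢.r z := Eq.trans hy (Eq.symm hz)
    have hzK : z ∈ 𝒢.inv '' tsupport ξ := hξ0 z fun h => hne (by simp [hF, h])
    refine ⟨⟨(z, 𝒢.inv (𝒢.mul (𝒢.inv y) z)), ⟨⟨hzK, mem_image_of_mem _ ?_⟩, ?_⟩, ?_⟩, hzK⟩
    · exact mem_tsupport_of_ne_zero f fun h => hne (by simp [hF, h])
    · change 𝒢.s z = 𝒢.r (𝒢.inv _)
      rw [𝒢.r_inv, 𝒢.s_inv_mul y z hyz]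
    · change 𝒢.mul z (𝒢.inv _) = y
      rw [𝒢.inv_mul_rev _ _ (by rw [𝒢.s_inv, hyz]), 𝒢.inv_inv,
        𝒢.mul_inv_cancel_left z y hyz.symm]
  have hKc := 𝒢.leftMul.isCompact_smulSet 𝒢.continuous_r hK
    ((isCompact_tsupport f).image 𝒢.continuous_inv)
  have hint := integrable_prod_of_continuousOn hcl hcl (lam.concentrated u) (lam.concentrated u)
    hFc hKc hK hsupp
  have hswap := integral_integral_swap_of_continuousOn hcl hcl (lam.concentrated u)
    (lam.concentrated u) hFc hKc hK hsupp
  have hfin : Integrable (fun y => ‖lam.mul f ξ (𝒢.inv y)‖ ^ 2) (lam.meas u) := by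
    have := ((lam.mul f ξ).continuous.comp 𝒢.continuous_inv).norm.pow 2
    refine lam.integrable this.continuousOn
      ((isCompact_tsupport (lam.mul f ξ)).image 𝒢.continuous_inv) fun y _ hy => ?_
    rw [eq_zero_of_notMem_tsupport (lam.mul f ξ) fun h => hy ⟨_, h, 𝒢.inv_inv y⟩]
    simp
  calc ∫ y, ‖lam.mul f ξ (𝒢.inv y)‖ ^ 2 ∂(lam.meas u)
      ≤ ∫ y, C₁ * ∫ z, F y z ∂(lam.meas u) ∂(lam.meas u) := by
        refine integral_mono_ae hfin (hint.integral_prod_left.const_mul C₁) ?_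
        filter_upwards [lam.ae_mem u] with y hy
        have := lam.norm_mul_sq_le hC₁ h1 ξ (𝒢.inv y)
        rwa [𝒢.s_inv, hy] at this
    _ = C₁ * ∫ z, ∫ y, F y z ∂(lam.meas u) ∂(lam.meas u) := by
        rw [integral_const_mul, hswap]
    _ ≤ C₁ * ∫ z, C₂ * ‖ξ (𝒢.inv z)‖ ^ 2 ∂(lam.meas u) := by
        refine mul_le_mul_of_nonneg_left (integral_mono_ae hint.integral_prod_right ?_ ?_) hC₁.le
        · refine (lam.integrable hξ.continuousOn hK fun y _ hy => ?_).const_mul C₂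
          by_contra hne
          exact hy (hξ0 y fun h => hne (by simp [h]))
        · filter_upwards [lam.ae_mem u] with z hz
          change ∫ y, ‖f (𝒢.mul (𝒢.inv y) z)‖ * ‖ξ (𝒢.inv z)‖ ^ 2 ∂(lam.meas u) ≤ _
          rw [integral_mul_const]
          refine mul_le_mul_of_nonneg_right ?_ (by positivity)
          -- Since `|f(y⁻¹z)| = |f^*(z⁻¹y)|`, left invariance applies to the integral in `y` as
          -- well, with `f^*` in place of `f`.
          have h3 := lam.integral_norm_mul_left_eq (𝒢.invol f) (𝒢.inv z)
          rw [𝒢.s_inv, hz] at h3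
          refine le_trans (le_of_eq ?_) (h3.le.trans (h2 _))
          refine integral_congr_ae ?_
          filter_upwards [lam.ae_mem u] with y hy
          rw [𝒢.invol_apply, norm_star, 𝒢.inv_mul_rev _ _ (by rw [𝒢.s_inv, hz, hy]), 𝒢.inv_inv]
    _ = C₁ * C₂ * ∫ z, ‖ξ (𝒢.inv z)‖ ^ 2 ∂(lam.meas u) := by
        rw [integral_const_mul, _root_.mul_assoc]

/-- Left convolution by `f`, as a linear map from `C_c(G)` to `L²(G, λ_u)`. -/
def convL2 (f : C_c(G, ℂ)) (u : B) : C_c(G, ℂ) →ₗ[ℂ] Lp ℂ 2 (rightMeas 𝒢 lam.meas u) :=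
  lam.toL2 u ∘ₗ
    { toFun := lam.mul f
      map_add' := lam.mul_add f
      map_smul' := fun c => lam.mul_smul c f }

/-- The regular representation `π_u`. -/
def regRep (f : C_c(G, ℂ)) (u : B) :
    Lp ℂ 2 (rightMeas 𝒢 lam.meas u) →L[ℂ] Lp ℂ 2 (rightMeas 𝒢 lam.meas u) :=
  (lam.convL2 f u).extendOfNorm (lam.toL2 u)

lemma regRep_toL2 (f : C_c(G, ℂ)) (u : B) (ξ : C_c(G, ℂ)) :
    lam.regRep f u (lam.toL2 u ξ) = lam.toL2 u (lam.mul f ξ) := by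
  obtain ⟨C, -, hC⟩ := lam.exists_norm_toL2_mul_le f
  exact LinearMap.extendOfNorm_eq (lam.denseRange_toL2 u) ⟨C, fun ξ => hC u ξ⟩ ξ

lemma exists_norm_regRep_le (f : C_c(G, ℂ)) : ∃ C, ∀ u, ‖lam.regRep f u‖ ≤ C := by
  obtain ⟨C, hC0, hC⟩ := lam.exists_norm_toL2_mul_le f
  exact ⟨C, fun u => LinearMap.opNorm_extendOfNorm_le (lam.denseRange_toL2 u) hC0 fun ξ => hC u ξ⟩

/-- The defining property prescribes the bounded operator on the dense image of `C_c(G)`, hence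
determines it. -/
lemma isRegRep_iff {f : C_c(G, ℂ)} {u : B}
    {T : Lp ℂ 2 (rightMeas 𝒢 lam.meas u) →L[ℂ] Lp ℂ 2 (rightMeas 𝒢 lam.meas u)} :
    IsRegRep 𝒢 lam.meas u f T ↔ T = lam.regRep f u := by
  constructor
  · intro h
    refine ContinuousLinearMap.coeFn_injective
      (DenseRange.equalizer (lam.denseRange_toL2 u) T.continuous (lam.regRep f u).continuous
        (funext fun ξ => ?_))
    change T (lam.toL2 u ξ) = lam.regRep f u (lam.toL2 u ξ)
    rw [regRep_toL2]
    exact lam.eq_toL2 (ξ := lam.mul f ξ) (h ξ _ (lam.coeFn_toL2 u ξ))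
  · rintro rfl ξ v hv
    rw [lam.eq_toL2 hv, regRep_toL2]
    exact lam.coeFn_toL2 u (lam.mul f ξ)

lemma regRep_eq_of_toL2 {f : C_c(G, ℂ)} {u : B}
    {T : Lp ℂ 2 (rightMeas 𝒢 lam.meas u) →L[ℂ] Lp ℂ 2 (rightMeas 𝒢 lam.meas u)}
    (h : ∀ ξ, T (lam.toL2 u ξ) = lam.toL2 u (lam.mul f ξ)) : lam.regRep f u = T := by
  refine (lam.isRegRep_iff.1 fun ξ v hv => ?_).symm
  rw [lam.eq_toL2 hv, h]
  exact lam.coeFn_toL2 u (lam.mul f ξ)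

lemma regRep_add (f g : C_c(G, ℂ)) (u : B) :
    lam.regRep (f + g) u = lam.regRep f u + lam.regRep g u :=
  lam.regRep_eq_of_toL2 fun ξ => by
    rw [_root_.add_apply, regRep_toL2, regRep_toL2, add_mul, map_add]

lemma regRep_smul (c : ℂ) (f : C_c(G, ℂ)) (u : B) :
    lam.regRep (c • f) u = c • lam.regRep f u :=
  lam.regRep_eq_of_toL2 fun ξ => by
    rw [_root_.smul_apply, regRep_toL2, smul_mul, LinearMap.map_smul]

lemma regRep_mul (f g : C_c(G, ℂ)) (u : B) :
    lam.regRep (lam.mul f g) u = lam.regRep f u * lam.regRep g u :=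
  lam.regRep_eq_of_toL2 fun ξ => by
    rw [mul_apply_eq_comp, regRep_toL2, regRep_toL2, mul_assoc]

/-- Both sides of the adjoint relation are `(η^* * f^* * ξ)(u)`. -/
lemma regRep_invol (f : C_c(G, ℂ)) (u : B) :
    lam.regRep (𝒢.invol f) u = star (lam.regRep f u) := by
  refine lam.regRep_eq_of_toL2 fun ξ => ?_
  refine (lam.denseRange_toL2 u).eq_of_inner_right ℂ fun η => ?_
  rw [ContinuousLinearMap.star_eq_adjoint, ContinuousLinearMap.adjoint_inner_right, regRep_toL2,
    inner_toL2, inner_toL2, invol_mul, mul_assoc]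

/-- With `u = r(x)`, the operator `π_u(f)` sends `f^*` to the class of `f * f^*`. If this class is
zero, full support makes the continuous function vanish at the unit `u`, where its value is `∫ |f|²
dλ^u`; full support again gives `f = 0` on `G^u`. -/
lemma eq_zero_of_regRep (f : C_c(G, ℂ)) (h : ∀ u, lam.regRep f u = 0) : f = 0 := by
  ext x
  have h1 := lam.regRep_toL2 f (𝒢.r x) (𝒢.invol f)
  rw [h, _root_.zero_apply] at h1
  set g := lam.mul f (𝒢.invol f) with hg
  have h2 : ∀ᵐ y ∂(lam.meas (𝒢.r x)), g (𝒢.inv y) = 0 := by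
    rw [← lam.ae_rightMeas (P := fun y => g y = 0)]
    filter_upwards [lam.coeFn_toL2 (𝒢.r x) g, Lp.coeFn_zero ℂ 2 (rightMeas 𝒢 lam.meas (𝒢.r x))]
      with y h3 h4
    rw [← h3, ← h1, h4]
    rfl
  have h3 := lam.eq_zero_of_ae (g.continuous.comp 𝒢.continuous_inv).continuousOn h2
    (𝒢.unit (𝒢.r x)) (𝒢.r_unit _)
  have h4 : ∫ t, ‖f t‖ ^ 2 ∂(lam.meas (𝒢.r x)) = 0 := by
    rw [← Complex.ofReal_inj, ← integral_complex_ofReal, Complex.ofReal_zero, ← h3]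
    change _ = g _
    rw [hg, 𝒢.inv_unit, mul_apply, 𝒢.r_unit]
    refine integral_congr_ae ?_
    filter_upwards [lam.ae_mem (𝒢.r x)] with t ht
    rw [← ht, 𝒢.inv_mul_unit, 𝒢.invol_apply, 𝒢.inv_inv, RCLike.star_def, Complex.mul_conj']
    push_cast
    rfl
  have hc : Continuous fun t => ‖f t‖ ^ 2 := f.continuous.norm.pow 2
  rw [integral_eq_zero_iff_of_nonneg (fun t => by positivity)
    (lam.integrable hc.continuousOn (isCompact_tsupport f) fun t _ ht => by
      rw [eq_zero_of_notMem_tsupport f ht]; simp)] at h4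
  have h5 := lam.eq_zero_of_ae hc.continuousOn h4 x rfl
  simpa using h5

end SmoothHaarSystem

/-! ### The embedding of the convolution algebra in the reduced C*-algebra -/

section Reduced

variable {G : Type uG} {B : Type uB} [TopologicalSpace G] [TopologicalSpace B] [MeasurableSpace G]
  {𝒢 : TopGroupoid G B} {lam : B → Measure G}

instance : StarOrderedRing (CStarRed 𝒢 lam) := CStarAlgebra.spectralOrderedRing _

lemma OpFamily.ext {S T : OpFamily 𝒢 lam} (h : ∀ u, S.1 u = T.1 u) : S = T :=
  Subtype.ext (funext h)

namespace CStarRed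

lemma ext {a b : CStarRed 𝒢 lam} (h : ∀ u, a.op u = b.op u) : a = b :=
  Subtype.ext (OpFamily.ext h)

/-- The component at `u`, as a *-homomorphism. -/
def opHom (u : B) : CStarRed 𝒢 lam →⋆ₙₐ[ℂ]
    (Lp ℂ 2 (rightMeas 𝒢 lam u) →L[ℂ] Lp ℂ 2 (rightMeas 𝒢 lam u)) where
  toFun a := a.op u
  map_smul' _ _ := rfl
  map_zero' := rfl
  map_add' _ _ := rfl
  map_mul' _ _ := rfl
  map_star' _ := rfl

open scoped CStarAlgebra in
lemma _root_.CFG.map_negPart_eq_zero {A H : Type*} [NonUnitalCStarAlgebra A]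
    [NormedAddCommGroup H] [InnerProductSpace ℂ H] [CompleteSpace H]
    (φ : A →⋆ₙₐ[ℂ] (H →L[ℂ] H)) {a : A} (ha : IsSelfAdjoint a) (h : 0 ≤ φ a) : φ a⁻ = 0 := by
  rw [CFC.negPart_def, NonUnitalStarAlgHom.map_cfcₙ φ (·⁻ : ℝ → ℝ) a (hφ := map_continuous φ)
    (hφa := h.isSelfAdjoint), ← CFC.negPart_def]
  exact (CFC.negPart_eq_zero_iff _ h.isSelfAdjoint).2 h

/-- The order is the algebra's own spectral order, so operators are compared through the functional
calculus: the component of `a⁻` at `u` is the negative part of that of `a`, hence zero, and the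
components together are injective. -/
lemma nonneg_of_op {a : CStarRed 𝒢 lam} (h : ∀ u, 0 ≤ a.op u) : 0 ≤ a := by
  have hsa : IsSelfAdjoint a := ext fun u => (map_star (opHom u) a).trans (h u).isSelfAdjoint
  have hneg : a⁻ = 0 := ext fun u => map_negPart_eq_zero (opHom u) hsa (h u)
  exact (CFC.negPart_eq_zero_iff a hsa).1 hneg

end CStarRed

end Reduced

namespace SmoothHaarSystem

variable {G : Type uG} {B : Type uB} [TopologicalSpace G] [LocallyCompactSpace G] [T2Space G]
  [SecondCountableTopology G] [MeasurableSpace G] [BorelSpace G] [TopologicalSpace B] [T2Space B]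
  {𝒢 : TopGroupoid G B} {m : ℕ} {𝔊 : ContFamily 𝒢.r m} (lam : SmoothHaarSystem 𝒢.leftMul 𝔊)

/-- The family of all `π_u(f)`. -/
def regFamily (f : C_c(G, ℂ)) : OpFamily 𝒢 lam.meas :=
  ⟨fun u => lam.regRep f u, by
    obtain ⟨C, hC⟩ := lam.exists_norm_regRep_le f
    exact memℓp_infty ⟨C, by rintro _ ⟨u, rfl⟩; exact hC u⟩⟩

/-- The families `(π_u(f))_u` form a *-algebra. -/
def regSubalgebra : NonUnitalStarSubalgebra ℂ (OpFamily 𝒢 lam.meas) where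
  carrier := range lam.regFamily
  add_mem' := by
    rintro _ _ ⟨f, rfl⟩ ⟨g, rfl⟩
    exact ⟨f + g, OpFamily.ext (lam.regRep_add f g)⟩
  zero_mem' := ⟨0, OpFamily.ext fun u => by
    change lam.regRep 0 u = 0
    simpa using lam.regRep_smul 0 0 u⟩
  mul_mem' := by
    rintro _ _ ⟨f, rfl⟩ ⟨g, rfl⟩
    exact ⟨lam.mul f g, OpFamily.ext (lam.regRep_mul f g)⟩
  smul_mem' := by
    rintro c _ ⟨f, rfl⟩
    exact ⟨c • f, OpFamily.ext (lam.regRep_smul c f)⟩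
  star_mem' := by
    rintro _ ⟨f, rfl⟩
    exact ⟨𝒢.invol f, OpFamily.ext (lam.regRep_invol f)⟩

/-- The inclusion of `C_c(G)` in the reduced C*-algebra. -/
def toRed : C_c(G, ℂ) →ₗ[ℂ] CStarRed 𝒢 lam.meas where
  toFun f := (⟨lam.regFamily f, subset_closure (NonUnitalStarAlgebra.subset_adjoin ℂ _
    ⟨f, fun _ => lam.isRegRep_iff.2 rfl⟩)⟩ : cstarSpan {T : OpFamily 𝒢 lam.meas |
      ∃ f : C_c(G, ℂ), ∀ u, IsRegRep 𝒢 lam.meas u f (T.1 u)})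
  map_add' f g := CStarRed.ext (lam.regRep_add f g)
  map_smul' c f := CStarRed.ext (lam.regRep_smul c f)

lemma op_toRed (f : C_c(G, ℂ)) (u : B) : (lam.toRed f).op u = lam.regRep f u := rfl

/-- The families `π(f)` already form a *-algebra, so the one they generate contains nothing else. -/
lemma denseRange_toRed : DenseRange lam.toRed := by
  intro a
  have h1 : NonUnitalStarAlgebra.adjoin ℂ {T : OpFamily 𝒢 lam.meas |
      ∃ f : C_c(G, ℂ), ∀ u, IsRegRep 𝒢 lam.meas u f (T.1 u)} ≤ lam.regSubalgebra :=
    NonUnitalStarAlgebra.adjoin_le fun T ⟨f, hf⟩ =>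
      ⟨f, OpFamily.ext fun u => (lam.isRegRep_iff.1 (hf u)).symm⟩
  have h2 : a.1 ∈ closure (range lam.regFamily) := closure_mono h1 a.2
  have h3 : IsInducing (fun b : CStarRed 𝒢 lam.meas => b.1) := IsInducing.subtypeVal
  rw [h3.closure_eq_preimage_closure_image]
  change a.1 ∈ closure _
  rwa [← range_comp]

theorem isDenseStarEmbedding_toRed : IsDenseStarEmbedding lam.mul 𝒢.invol lam.toRed where
  injective := by
    rw [← LinearMap.ker_eq_bot, LinearMap.ker_eq_bot']
    intro f hf
    refine lam.eq_zero_of_regRep f fun u => ?_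
    rw [← op_toRed, hf]
    rfl
  dense := lam.denseRange_toRed
  map_mul f g := CStarRed.ext (lam.regRep_mul f g)
  map_invol f := CStarRed.ext (lam.regRep_invol f)

open scoped ComplexOrder in
-- The hypothesis is the quadratic form of `π_u(f)` at the dense vectors `ξ`, by `inner_toL2`; its
-- nonnegativity passes to limits.
theorem toRed_nonneg {f : C_c(G, ℂ)} (hf : ∀ ξ : C_c(G, ℂ), ∀ u,
    0 ≤ lam.mul (𝒢.invol ξ) (lam.mul f ξ) (𝒢.unit u)) : 0 ≤ lam.toRed f := by
  refine CStarRed.nonneg_of_op fun u => ?_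
  rw [op_toRed, ContinuousLinearMap.nonneg_iff_isPositive, ContinuousLinearMap.isPositive_iff_complex]
  intro v
  have key : 0 ≤ inner ℂ v (lam.regRep f u v) := by
    induction v using (lam.denseRange_toL2 u).induction_on with
    | hp =>
      refine isClosed_le continuous_const ?_
      fun_prop
    | ih ξ =>
      rw [regRep_toL2, inner_toL2]
      exact hf ξ u
  have h2 := Complex.nonneg_iff.1 key
  refine ⟨Complex.ext ?_ ?_, ?_⟩
  · simp
  · rw [← inner_conj_symm, Complex.conj_im, ← h2.2]
    simp
  · rw [← inner_conj_symm, RCLike.conj_re]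
    exact h2.1

end SmoothHaarSystem

/-! ### Continuous sections and their translates -/

namespace GroupoidAction

variable {G : Type uG} {B : Type uB} [TopologicalSpace G] [TopologicalSpace B]
  {𝒢 : TopGroupoid G B} {X : Type uX} [TopologicalSpace X] {p : X → B} (α : GroupoidAction 𝒢 p)

lemma p_inv_smul (g : G) (x : X) (h : 𝒢.r g = p x) : p (α.smul (𝒢.inv g) x) = 𝒢.s g := by
  rw [α.p_smul _ _ (by rw [𝒢.s_inv, h]), 𝒢.r_inv]

lemma smul_inv_smul (g : G) (x : X) (h : 𝒢.r g = p x) : α.smul g (α.smul (𝒢.inv g) x) = x := by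
  have := α.inv_smul_smul (𝒢.inv g) x (by rw [𝒢.s_inv, h])
  rwa [𝒢.inv_inv] at this

lemma unit_smul (x : X) : α.smul (𝒢.unit (p x)) x = x := by
  have h := α.inv_smul_smul (𝒢.unit (p x)) x (𝒢.s_unit _)
  have h1 := 𝒢.mul_unit (𝒢.unit (p x))
  rw [𝒢.s_unit] at h1
  rwa [𝒢.inv_unit, α.smul_smul _ _ _ (by rw [𝒢.s_unit, 𝒢.r_unit]) (𝒢.s_unit _), h1] at h

lemma mul_inv_smul (g h : G) (x : X) (hgh : 𝒢.s g = 𝒢.r h) (hx : 𝒢.r g = p x) :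
    α.smul (𝒢.inv (𝒢.mul g h)) x = α.smul (𝒢.inv h) (α.smul (𝒢.inv g) x) := by
  rw [𝒢.inv_mul_rev g h hgh, α.smul_smul _ _ _ (by rw [𝒢.s_inv, 𝒢.r_inv, hgh])
    (by rw [𝒢.s_inv, hx])]

lemma continuousOn_inv_smul :
    ContinuousOn (fun z : G × X => α.smul (𝒢.inv z.1) z.2) {z | 𝒢.r z.1 = p z.2} := by
  refine α.continuousOn_smul.comp (f := fun z : G × X => (𝒢.inv z.1, z.2)) ?_ ?_
  · exact ((𝒢.continuous_inv.comp continuous_fst).prodMk continuous_snd).continuousOn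
  · intro z hz
    simpa [𝒢.s_inv] using hz

end GroupoidAction

lemma ContFamily.SmoothOn.continuousOn {X : Type uX} {T : Type uT} [TopologicalSpace X]
    [TopologicalSpace T] {p : X → T} {k : ℕ} {𝔛 : ContFamily p k} {N : Type*}
    [NormedAddCommGroup N] [NormedSpace ℝ N] {f : X → N} {O : Set X} (hO : IsOpen O)
    (h : 𝔛.SmoothOn f O) : ContinuousOn f O := by
  intro x hx
  obtain ⟨φ, hφ, hxφ⟩ := 𝔛.cover x
  have h1 : ContinuousOn (fun z => f (φ.symm z)) (φ.target ∩ φ.symm ⁻¹' O) := by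
    refine ((continuousMultilinearCurryFin0 ℝ (Coord k) N).continuous.comp_continuousOn
      ((h φ hφ).2 0)).congr fun z hz => by simp
  have h2 : ContinuousOn (fun y => f (φ.symm (φ y))) (φ.source ∩ O) :=
    h1.comp (φ.continuousOn.mono inter_subset_left) fun y hy =>
      ⟨φ.map_source hy.1, by simpa [φ.left_inv hy.1] using hy.2⟩
  refine ((h2.congr fun y hy => by rw [φ.left_inv hy.1]).continuousAt
    ((φ.open_source.inter hO).mem_nhds ⟨hxφ, hx⟩)).continuousWithinAt

section VectorBundle

variable {X : Type uX} [TopologicalSpace X] {q : ℕ} {E : X → Type uE}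
  [∀ x, NormedAddCommGroup (E x)] [∀ x, InnerProductSpace ℂ (E x)]

lemma mk_toFibre {x : X} (e : TotalSpace (Fib q) E) (h : e.proj = x) :
    (⟨x, toFibre x e⟩ : TotalSpace (Fib q) E) = e := by
  subst h
  simp [toFibre]

variable [TopologicalSpace (TotalSpace (Fib q) E)] [FiberBundle (Fib q) E]
  [VectorBundle ℂ (Fib q) E]

variable (q) in
include q in
lemma finiteDimensional_fibre (x : X) : FiniteDimensional ℂ (E x) :=
  LinearEquiv.finiteDimensional ((trivializationAt (Fib q) E x).linearEquivAt ℂ x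
    (FiberBundle.mem_baseSet_trivializationAt' x)).symm

/-- The inner product of two continuous families of vectors is continuous. -/
lemma SmoothBundle.SmoothMetric.continuousOn_inner {B : Type uB} [TopologicalSpace B] {p : X → B}
    {k : ℕ} {𝔛 : ContFamily p k} {𝔈 : SmoothBundle 𝔛 q E} (h𝔈 : 𝔈.SmoothMetric)
    {Y : Type*} [TopologicalSpace Y] {S : Set Y} {a : Y → X} {v w : ∀ y, E (a y)}
    (hv : ContinuousOn (fun y => (⟨a y, v y⟩ : TotalSpace (Fib q) E)) S)
    (hw : ContinuousOn (fun y => (⟨a y, w y⟩ : TotalSpace (Fib q) E)) S) :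
    ContinuousOn (fun y => inner ℂ (v y) (w y)) S := by
  intro y₀ hy₀
  obtain ⟨e, he, hye⟩ := 𝔈.cover (a y₀)
  have := 𝔈.linear e he
  have ha : ContinuousOn a S := (FiberBundle.continuous_proj (Fib q) E).comp_continuousOn hv
  have hnhds : a ⁻¹' e.baseSet ∈ 𝓝[S] y₀ := (ha y₀ hy₀) (e.open_baseSet.mem_nhds hye)
  have hcoord : ∀ u : ∀ y, E (a y),
      ContinuousOn (fun y => (⟨a y, u y⟩ : TotalSpace (Fib q) E)) S →
      ContinuousWithinAt (fun y => (e ⟨a y, u y⟩).2) S y₀ := fun u hu =>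
    continuous_snd.continuousAt.comp_continuousWithinAt
      ((e.continuousAt (e.mem_source.2 hye)).comp_continuousWithinAt
        (f := fun y => (⟨a y, u y⟩ : TotalSpace (Fib q) E)) (hu y₀ hy₀))
  -- In the local frame given by `b`, the inner product is a finite sum of continuous coordinates
  -- times the matrix entries of the metric.
  let b : Fin q → Fib q := fun i => EuclideanSpace.single i 1
  have hm : ∀ i j, ContinuousWithinAt
      (fun y => inner ℂ (e.symm (a y) (b i)) (e.symm (a y) (b j))) S y₀ := fun i j =>
    (((h𝔈 e he (b i) (b j)).continuousOn e.open_baseSet).continuousAt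
      (e.open_baseSet.mem_nhds hye)).comp_continuousWithinAt (ha y₀ hy₀)
  have hexp : ∀ y, a y ∈ e.baseSet → ∀ u : E (a y),
      u = ∑ i, (e ⟨a y, u⟩).2 i • e.symm (a y) (b i) := by
    intro y hy u
    have h1 : e.symm (a y) (e ⟨a y, u⟩).2 = u := e.symm_apply_apply_mk hy u
    have h2 : (e ⟨a y, u⟩).2 = ∑ i, (e ⟨a y, u⟩).2 i • b i := by
      ext j
      simp [b, Finset.sum_apply, Pi.single_apply]
    conv_lhs => rw [← h1, h2]
    rw [← e.coe_symmₗ (R := ℂ) hy, map_sum]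
    simp only [_root_.map_smul]
  have hsum : ContinuousWithinAt (fun y => ∑ j, (e ⟨a y, w y⟩).2 j * ∑ i,
      star ((e ⟨a y, v y⟩).2 i) * inner ℂ (e.symm (a y) (b i)) (e.symm (a y) (b j))) S y₀ := by
    refine tendsto_finsetSum _ fun j _ => Filter.Tendsto.mul ?_ (tendsto_finsetSum _ fun i _ => ?_)
    · exact (EuclideanSpace.proj (𝕜 := ℂ) j).continuous.continuousAt.comp_continuousWithinAt
        (hcoord w hw)
    · exact ((EuclideanSpace.proj (𝕜 := ℂ) i).continuous.continuousAt.comp_continuousWithinAt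
        (hcoord v hv)).star.mul (hm i j)
  refine hsum.congr_of_eventuallyEq ?_ ?_
  · filter_upwards [hnhds] with y hy
    conv_lhs => rw [hexp y hy (v y), hexp y hy (w y)]
    simp only [sum_inner, inner_sum, inner_smul_left, inner_smul_right, RCLike.star_def]
  · conv_lhs => rw [hexp y₀ hye (v y₀), hexp y₀ hye (w y₀)]
    simp only [sum_inner, inner_sum, inner_smul_left, inner_smul_right, RCLike.star_def]

namespace GBundle

variable {G : Type uG} {B : Type uB} [TopologicalSpace G] [TopologicalSpace B]
  {𝒢 : TopGroupoid G B} {p : X → B} {α : GroupoidAction 𝒢 p} {k : ℕ} {𝔛 : ContFamily p k}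
  {𝔈 : SmoothBundle 𝔛 q E} (𝒜 : GBundle α 𝔈)

/-- Stated in the total space, since `g(g⁻¹x)` and `x` are equal only by a theorem and their fibres
are distinct types. -/
lemma mk_translate (g : G) (ξ : ∀ x, E x) (x : X) (h : 𝒢.r g = p x) :
    (⟨x, 𝒜.translate g ξ x⟩ : TotalSpace (Fib q) E) =
      𝒜.act.smul g ⟨α.smul (𝒢.inv g) x, ξ (α.smul (𝒢.inv g) x)⟩ := by
  refine mk_toFibre _ ?_
  rw [𝒜.proj_smul g _ (α.p_inv_smul g x h).symm]
  exact α.smul_inv_smul g x h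

/-- The action of `g` as a linear map from the fibre at `g⁻¹ x` to the fibre at `x`. -/
def fibreMap (g : G) (x : X) (h : 𝒢.r g = p x) : E (α.smul (𝒢.inv g) x) →ₗ[ℂ] E x where
  toFun v := toFibre x (𝒜.act.smul g ⟨α.smul (𝒢.inv g) x, v⟩)
  map_add' v w := by
    have := 𝒜.smul_add g (α.smul (𝒢.inv g) x) (α.p_inv_smul g x h).symm v w
    rwa [α.smul_inv_smul g x h] at this
  map_smul' c v := by
    have := 𝒜.smul_smul g (α.smul (𝒢.inv g) x) (α.p_inv_smul g x h).symm c v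
    rwa [α.smul_inv_smul g x h] at this

lemma translate_eq (g : G) (ξ : ∀ x, E x) (x : X) (h : 𝒢.r g = p x) :
    𝒜.translate g ξ x = 𝒜.fibreMap g x h (ξ (α.smul (𝒢.inv g) x)) := rfl

lemma translate_add (g : G) (ξ η : ∀ x, E x) (x : X) (h : 𝒢.r g = p x) :
    𝒜.translate g (ξ + η) x = 𝒜.translate g ξ x + 𝒜.translate g η x := by
  simp only [𝒜.translate_eq _ _ x h, Pi.add_apply, map_add]

lemma translate_smul (g : G) (c : ℂ) (ξ : ∀ x, E x) (x : X) (h : 𝒢.r g = p x) :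
    𝒜.translate g (c • ξ) x = c • 𝒜.translate g ξ x := by
  simp only [𝒜.translate_eq _ _ x h, Pi.smul_apply, map_smul]

lemma translate_of_eq_zero (g : G) (ξ : ∀ x, E x) (x : X) (h : 𝒢.r g = p x)
    (h0 : ξ (α.smul (𝒢.inv g) x) = 0) : 𝒜.translate g ξ x = 0 := by
  rw [𝒜.translate_eq _ _ x h, h0, map_zero]

lemma translate_translate (g h : G) (ξ : ∀ x, E x) (x : X) (hgh : 𝒢.s g = 𝒢.r h)
    (hx : 𝒢.r g = p x) :
    𝒜.translate g (𝒜.translate h ξ) x = 𝒜.translate (𝒢.mul g h) ξ x := by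
  have hy : 𝒢.r h = p (α.smul (𝒢.inv g) x) := by rw [α.p_inv_smul g x hx, hgh]
  refine TotalSpace.mk_injective (F := Fib q) x ?_
  change (⟨x, _⟩ : TotalSpace (Fib q) E) = ⟨x, _⟩
  rw [𝒜.mk_translate g _ x hx, 𝒜.mk_translate h _ _ hy,
    𝒜.mk_translate _ _ x (by rw [𝒢.r_mul g h hgh, hx]),
    𝒜.act.smul_smul g h _ hgh (α.p_inv_smul h _ hy).symm, α.mul_inv_smul g h x hgh hx]

lemma translate_unit (ξ : ∀ x, E x) (x : X) : 𝒜.translate (𝒢.unit (p x)) ξ x = ξ x := by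
  refine TotalSpace.mk_injective (F := Fib q) x ?_
  change (⟨x, _⟩ : TotalSpace (Fib q) E) = ⟨x, _⟩
  rw [𝒜.mk_translate _ _ x (𝒢.r_unit _), 𝒢.inv_unit, α.unit_smul]
  exact 𝒜.act.unit_smul ⟨x, ξ x⟩

lemma IsIsometric.inner_translate {𝒜 : GBundle α 𝔈} (hiso : 𝒜.IsIsometric) (g : G)
    (ξ η : ∀ x, E x) (x : X) (h : 𝒢.r g = p x) :
    inner ℂ (𝒜.translate g ξ x) (𝒜.translate g η x) =
      inner ℂ (ξ (α.smul (𝒢.inv g) x)) (η (α.smul (𝒢.inv g) x)) := by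
  have := hiso g (α.smul (𝒢.inv g) x) (α.p_inv_smul g x h).symm
    (ξ (α.smul (𝒢.inv g) x)) (η (α.smul (𝒢.inv g) x))
  rwa [α.smul_inv_smul g x h] at this

/-- The action of `g` between fibres is linear and the fibres are finite dimensional, so it is
continuous and commutes with integrals. -/
lemma translate_integral {Y : Type*} [MeasurableSpace Y] {ν : Measure Y} (g : G)
    (F : Y → ∀ x, E x) (x : X) (h : 𝒢.r g = p x)
    (hF : Integrable (fun a => F a (α.smul (𝒢.inv g) x)) ν) :
    𝒜.translate g (fun y => ∫ a, F a y ∂ν) x = ∫ a, 𝒜.translate g (F a) x ∂ν := by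
  have := finiteDimensional_fibre (E := E) q x
  have := finiteDimensional_fibre (E := E) q (α.smul (𝒢.inv g) x)
  have := FiniteDimensional.complete ℂ (E x)
  have := FiniteDimensional.complete ℂ (E (α.smul (𝒢.inv g) x))
  exact ((𝒜.fibreMap g x h).toContinuousLinearMap.integral_comp_comm hF).symm

lemma continuousOn_translate {ξ : ∀ x, E x}
    (hξ : Continuous fun x => (⟨x, ξ x⟩ : TotalSpace (Fib q) E)) :
    ContinuousOn (fun z : G × X => (⟨z.2, 𝒜.translate z.1 ξ z.2⟩ : TotalSpace (Fib q) E))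
      {z | 𝒢.r z.1 = p z.2} := by
  have h1 : ContinuousOn (fun z : G × X => (z.1,
      (⟨α.smul (𝒢.inv z.1) z.2, ξ (α.smul (𝒢.inv z.1) z.2)⟩ : TotalSpace (Fib q) E)))
      {z | 𝒢.r z.1 = p z.2} :=
    continuous_fst.continuousOn.prodMk (hξ.comp_continuousOn α.continuousOn_inv_smul)
  exact (𝒜.act.continuousOn_smul.comp h1 fun z hz => (α.p_inv_smul z.1 z.2 hz).symm).congr
    fun z hz => 𝒜.mk_translate z.1 ξ z.2 hz

lemma continuousOn_translate_left {ξ : ∀ x, E x}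
    (hξ : Continuous fun x => (⟨x, ξ x⟩ : TotalSpace (Fib q) E)) (x : X) :
    ContinuousOn (fun g => 𝒜.translate g ξ x) (𝒢.r ⁻¹' {p x}) := by
  rw [(FiberBundle.totalSpaceMk_isInducing (Fib q) E x).continuousOn_iff]
  exact (𝒜.continuousOn_translate hξ).comp (f := fun g => (g, x)) (by fun_prop) fun _ hg => hg

end GBundle

end VectorBundle

lemma TopGroupoid.inv_mul_self_mul {G : Type uG} {B : Type uB} [TopologicalSpace G]
    [TopologicalSpace B] (𝒢 : TopGroupoid G B) (g h : G) (hh : 𝒢.s g = 𝒢.r h) :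
    𝒢.mul (𝒢.inv (𝒢.mul g h)) g = 𝒢.inv h := by
  rw [𝒢.inv_mul_rev g h hh, 𝒢.mul_assoc _ _ _ (by rw [𝒢.s_inv, 𝒢.r_inv, hh]) (𝒢.s_inv g),
    𝒢.inv_mul, hh, 𝒢.inv_mul_unit]

/-- If `t⁻¹ g ∈ K` then `t ∈ g K⁻¹`. -/
lemma TopGroupoid.mem_smulSet_of_inv_mul_mem {G : Type uG} {B : Type uB} [TopologicalSpace G]
    [TopologicalSpace B] (𝒢 : TopGroupoid G B) {K L : Set G} {t g : G} (h : 𝒢.r t = 𝒢.r g)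
    (hg : g ∈ L) (hK : 𝒢.mul (𝒢.inv t) g ∈ K) : t ∈ 𝒢.leftMul.smulSet L (𝒢.inv '' K) := by
  refine ⟨(g, 𝒢.inv (𝒢.mul (𝒢.inv t) g)), ⟨⟨hg, mem_image_of_mem _ hK⟩, ?_⟩, ?_⟩
  · change 𝒢.s g = 𝒢.r (𝒢.inv _)
    rw [𝒢.r_inv, 𝒢.s_inv_mul t g h]
  · change 𝒢.mul g (𝒢.inv _) = t
    rw [𝒢.inv_mul_rev _ _ (by rw [𝒢.s_inv, h]), 𝒢.inv_inv, 𝒢.mul_inv_cancel_left g t h.symm]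

/-! ### The pre-Hilbert module of continuous sections -/

namespace GBundle

variable {G : Type uG} {B : Type uB} [TopologicalSpace G] [LocallyCompactSpace G] [T2Space G]
  [SecondCountableTopology G] [MeasurableSpace G] [BorelSpace G] [TopologicalSpace B] [T2Space B]
  {𝒢 : TopGroupoid G B} {m : ℕ} {𝔊 : ContFamily 𝒢.r m} (lam : SmoothHaarSystem 𝒢.leftMul 𝔊)
  {X : Type uX} [TopologicalSpace X] [LocallyCompactSpace X] [T2Space X]
  [SecondCountableTopology X] [MeasurableSpace X] [BorelSpace X]
  {p : X → B} {n : ℕ} {𝔛 : ContFamily p n} {α : GroupoidAction 𝒢 p} (mu : SmoothHaarSystem α 𝔛)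
  {q : ℕ} {E : X → Type uE} [∀ x, NormedAddCommGroup (E x)] [∀ x, InnerProductSpace ℂ (E x)]
  [TopologicalSpace (TotalSpace (Fib q) E)] [FiberBundle (Fib q) E] [VectorBundle ℂ (Fib q) E]
  {𝔈 : SmoothBundle 𝔛 q E} (𝒜 : GBundle α 𝔈)

lemma translate_congr (g : G) {ξ η : ∀ x, E x} (x : X) (h : 𝒢.r g = p x)
    (he : ξ (α.smul (𝒢.inv g) x) = η (α.smul (𝒢.inv g) x)) :
    𝒜.translate g ξ x = 𝒜.translate g η x := by
  rw [𝒜.translate_eq g ξ x h, 𝒜.translate_eq g η x h, he]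

/-! #### The action -/

lemma continuousOn_act_integrand (k : CcSection q E) {f : G → ℂ} {x : X}
    (hf : ContinuousOn f (𝒢.r ⁻¹' {p x})) :
    ContinuousOn (fun g => f g • 𝒜.translate g k.1 x) (𝒢.r ⁻¹' {p x}) :=
  hf.smul (𝒜.continuousOn_translate_left k.2.1 x)

lemma continuous_comp_inv (𝒢 : TopGroupoid G B) (f : C_c(G, ℂ)) :
    Continuous fun g => f (𝒢.inv g) := f.continuous.comp 𝒢.continuous_inv

lemma comp_inv_eq_zero (𝒢 : TopGroupoid G B) (f : C_c(G, ℂ)) (g : G)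
    (hg : g ∉ 𝒢.inv '' tsupport f) : f (𝒢.inv g) = 0 :=
  eq_zero_of_notMem_tsupport f fun h => hg ⟨_, h, 𝒢.inv_inv g⟩

lemma isCompact_inv_tsupport (𝒢 : TopGroupoid G B) (f : C_c(G, ℂ)) :
    IsCompact (𝒢.inv '' tsupport f) := (isCompact_tsupport f).image 𝒢.continuous_inv

lemma integrable_act (k : CcSection q E) (f : C_c(G, ℂ)) (x : X) :
    Integrable (fun g => f (𝒢.inv g) • 𝒜.translate g k.1 x) (lam.meas (p x)) :=
  lam.integrable (𝒜.continuousOn_act_integrand k (continuous_comp_inv 𝒢 f).continuousOn)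
    (isCompact_inv_tsupport 𝒢 f) fun g _ hg => by rw [comp_inv_eq_zero 𝒢 f g hg, zero_smul]

/-- Continuity is local in `x`: a trivialization commutes with the fibre integral and turns it into
an integral with values in the fixed space `Fib q`, to which `continuous_integral_fibre` applies. -/
lemma continuous_act (k : CcSection q E) (f : C_c(G, ℂ)) :
    Continuous fun x => (⟨x, ∫ g, f (𝒢.inv g) • 𝒜.translate g k.1 x ∂(lam.meas (p x))⟩ :
      TotalSpace (Fib q) E) := by
  refine continuous_iff_continuousAt.2 fun x₀ =>
    (FiberBundle.continuousAt_totalSpace (Fib q) _).2 ⟨continuousAt_id, ?_⟩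
  set e := trivializationAt (Fib q) E x₀ with he
  have hx₀ : x₀ ∈ e.baseSet := FiberBundle.mem_baseSet_trivializationAt' x₀
  have hc : Continuous fun x : e.baseSet =>
      ∫ g, f (𝒢.inv g) • (e ⟨x, 𝒜.translate g k.1 x⟩).2 ∂(lam.meas (p x)) := by
    refine lam.continuous_integral_fibre (T := e.baseSet) (q := fun x => p x)
      (𝔛.continuous_proj.comp continuous_subtype_val)
      (F := fun x g => f (𝒢.inv g) • (e ⟨x, 𝒜.translate g k.1 x⟩).2) ?_
      (isCompact_inv_tsupport 𝒢 f) fun x g _ hg => by rw [comp_inv_eq_zero 𝒢 f g hg, zero_smul]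
    refine ((continuous_comp_inv 𝒢 f).comp continuous_snd).continuousOn.smul
      (continuous_snd.comp_continuousOn (e.continuousOn.comp ((𝒜.continuousOn_translate
        k.2.1).comp (f := fun z : e.baseSet × G => (z.2, (z.1 : X))) (by fun_prop) ?_) ?_))
    · intro z hz
      exact Eq.symm hz
    · intro z _
      exact e.mem_source.2 z.1.2
  have hc' : ContinuousOn (fun x => (e ⟨x, ∫ g, f (𝒢.inv g) • 𝒜.translate g k.1 x
      ∂(lam.meas (p x))⟩).2) e.baseSet := by
    rw [continuousOn_iff_continuous_domRestrict]
    refine hc.congr fun x => ?_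
    have := finiteDimensional_fibre (E := E) q x.1
    have := FiniteDimensional.complete ℂ (E x.1)
    have hl : ∀ v : E x.1, (e ⟨x.1, v⟩).2 = e.continuousLinearMapAt ℂ x.1 v := fun v => by
      rw [e.continuousLinearMapAt_apply ℂ, e.coe_linearMapAt_of_mem (R := ℂ) x.2]
    change _ = (e ⟨x.1, _⟩).2
    rw [hl, ← ContinuousLinearMap.integral_comp_comm _ (𝒜.integrable_act lam k f x)]
    simp only [hl, _root_.map_smul]
  exact hc'.continuousAt (e.open_baseSet.mem_nhds hx₀)

/-- The action `(k f)(x) = ∫ (L_g k)(x) f(g⁻¹) dλ^{p x}(g)`. -/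
def rightAct (k : CcSection q E) (f : C_c(G, ℂ)) : CcSection q E :=
  ⟨fun x => ∫ g, f (𝒢.inv g) • 𝒜.translate g k.1 x ∂(lam.meas (p x)),
    𝒜.continuous_act lam k f, by
    obtain ⟨K, hK, hk⟩ := k.2.2
    refine ⟨_, α.isCompact_smulSet 𝔛.continuous_proj (isCompact_inv_tsupport 𝒢 f) hK,
      fun x hx => integral_eq_zero_of_ae ?_⟩
    filter_upwards [lam.ae_mem (p x)] with g hg
    by_contra hne
    refine hx ⟨(g, α.smul (𝒢.inv g) x), ⟨⟨?_, ?_⟩, (α.p_inv_smul g x hg).symm⟩,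
      α.smul_inv_smul g x hg⟩
    · by_contra h
      exact hne (by simp [comp_inv_eq_zero 𝒢 f g h])
    · by_contra h
      exact hne (by simp [𝒜.translate_of_eq_zero g k.1 x hg (hk _ h)])⟩

lemma rightAct_apply (k : CcSection q E) (f : C_c(G, ℂ)) (x : X) :
    (𝒜.rightAct lam k f).1 x = ∫ g, f (𝒢.inv g) • 𝒜.translate g k.1 x ∂(lam.meas (p x)) := rfl

lemma continuousOn_translate_rightAct_integrand (k : CcSection q E) (f : C_c(G, ℂ)) {g : G} {x : X}
    (h : 𝒢.r g = p x) :
    ContinuousOn (fun t => f (𝒢.mul (𝒢.inv t) g) • 𝒜.translate t k.1 x) (𝒢.r ⁻¹' {p x}) := by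
  refine 𝒜.continuousOn_act_integrand k (f.continuous.comp_continuousOn
    (𝒢.continuousOn_inv_mul.comp (f := fun t => (t, g)) (by fun_prop) ?_))
  intro t ht
  exact Eq.trans ht h.symm

lemma integrable_translate_rightAct (k : CcSection q E) (f : C_c(G, ℂ)) {g : G} {x : X}
    (h : 𝒢.r g = p x) :
    Integrable (fun t => f (𝒢.mul (𝒢.inv t) g) • 𝒜.translate t k.1 x) (lam.meas (p x)) := by
  refine lam.integrable (𝒜.continuousOn_translate_rightAct_integrand k f h)
    (𝒢.leftMul.isCompact_smulSet 𝒢.continuous_r (isCompact_singleton (x := g))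
      (isCompact_inv_tsupport 𝒢 f)) fun t ht hn => ?_
  by_contra hne
  refine hn (𝒢.mem_smulSet_of_inv_mul_mem (ht.trans h.symm) (mem_singleton g) ?_)
  exact mem_tsupport_of_ne_zero f fun h0 => hne (by rw [h0, zero_smul])

/-- Move `L_g` inside the integral and substitute `t = gl`. Compatibility of the action with
convolution and with the inner product both rest on this formula. -/
lemma translate_rightAct (k : CcSection q E) (f : C_c(G, ℂ)) (g : G) (x : X) (h : 𝒢.r g = p x) :
    𝒜.translate g (𝒜.rightAct lam k f).1 x =
      ∫ t, f (𝒢.mul (𝒢.inv t) g) • 𝒜.translate t k.1 x ∂(lam.meas (p x)) := by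
  have hp := α.p_inv_smul g x h
  have h1 : 𝒜.translate g (𝒜.rightAct lam k f).1 x = 𝒜.translate g
      (fun y => ∫ l, f (𝒢.inv l) • 𝒜.translate l k.1 y ∂(lam.meas (𝒢.s g))) x :=
    𝒜.translate_congr g x h (by rw [rightAct_apply, hp])
  rw [h1, 𝒜.translate_integral g (fun l y => f (𝒢.inv l) • 𝒜.translate l k.1 y) x h
    (by have := 𝒜.integrable_act lam k f (α.smul (𝒢.inv g) x); rwa [hp] at this), ← h,
    ← lam.integral_smul g rfl (by
      rw [h]; exact 𝒜.continuousOn_translate_rightAct_integrand k f h)]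
  refine integral_congr_ae ?_
  filter_upwards [lam.ae_mem (𝒢.s g)] with l hl
  change 𝒜.translate g (f (𝒢.inv l) • 𝒜.translate l k.1) x =
    f (𝒢.mul (𝒢.inv (𝒢.mul g l)) g) • 𝒜.translate (𝒢.mul g l) k.1 x
  rw [𝒜.translate_smul g _ _ x h, 𝒜.translate_translate g l k.1 x hl.symm h,
    𝒢.inv_mul_self_mul g l hl.symm]

/-- Both sides are iterated integrals of `h(g⁻¹) f(t⁻¹g) L_t k(x)`, in opposite orders. -/
lemma rightAct_mul (k : CcSection q E) (f h : C_c(G, ℂ)) :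
    𝒜.rightAct lam k (lam.mul f h) = 𝒜.rightAct lam (𝒜.rightAct lam k f) h := by
  refine Subtype.ext (funext fun x => ?_)
  have := finiteDimensional_fibre (E := E) q x
  have := FiniteDimensional.complete ℂ (E x)
  set F : G → G → E x := fun g t =>
    (h (𝒢.inv g) * f (𝒢.mul (𝒢.inv t) g)) • 𝒜.translate t k.1 x with hF
  have hcl := 𝔊.isClosed_fibre (p x)
  have hFc : ContinuousOn (fun w : G × G => F w.1 w.2)
      ((𝒢.r ⁻¹' {p x}) ×ˢ (𝒢.r ⁻¹' {p x})) := by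
    refine (((continuous_comp_inv 𝒢 h).comp continuous_fst).continuousOn.mul
      (f.continuous.comp_continuousOn (𝒢.continuousOn_inv_mul.comp
        (f := fun w : G × G => (w.2, w.1)) (by fun_prop) ?_))).smul
      ((𝒜.continuousOn_translate_left k.2.1 x).comp continuous_snd.continuousOn fun w hw => hw.2)
    intro w hw
    exact Eq.trans hw.2 (Eq.symm hw.1)
  have hswap := integral_integral_swap_of_continuousOn hcl hcl (lam.concentrated _)
    (lam.concentrated _) hFc (isCompact_inv_tsupport 𝒢 h)
    (𝒢.leftMul.isCompact_smulSet 𝒢.continuous_r (isCompact_inv_tsupport 𝒢 h)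
      (isCompact_inv_tsupport 𝒢 f)) (by
    intro g hg t ht hne
    have hgh : g ∈ 𝒢.inv '' tsupport h := by
      by_contra hn
      exact hne (by simp [hF, comp_inv_eq_zero 𝒢 h g hn])
    refine ⟨hgh, 𝒢.mem_smulSet_of_inv_mul_mem (Eq.trans ht (Eq.symm hg)) hgh ?_⟩
    exact mem_tsupport_of_ne_zero f fun h0 => hne (by simp [hF, h0]))
  have hL : (𝒜.rightAct lam k (lam.mul f h)).1 x
      = ∫ t, ∫ g, F g t ∂(lam.meas (p x)) ∂(lam.meas (p x)) := by
    rw [rightAct_apply]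
    refine integral_congr_ae ?_
    filter_upwards [lam.ae_mem (p x)] with t ht
    rw [hF, integral_smul_const, lam.mul_apply', 𝒢.s_inv, ht]
    simp only [mul_comm]
  have hR : (𝒜.rightAct lam (𝒜.rightAct lam k f) h).1 x
      = ∫ g, ∫ t, F g t ∂(lam.meas (p x)) ∂(lam.meas (p x)) := by
    rw [rightAct_apply]
    refine integral_congr_ae ?_
    filter_upwards [lam.ae_mem (p x)] with g hg
    rw [𝒜.translate_rightAct lam k f g x hg, ← integral_smul]
    simp only [hF, mul_smul]
  rw [hL, hR, hswap]

/-! #### The inner product -/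

variable {𝒜} (h𝔈 : 𝔈.SmoothMetric) (hα : α.IsProper) (hiso : 𝒜.IsIsometric)

include h𝔈 in
variable (𝒜) in
lemma continuousOn_inner_translate (k l : CcSection q E) :
    ContinuousOn (fun z : G × X => inner ℂ (k.1 z.2) (𝒜.translate z.1 l.1 z.2))
      {z | 𝒢.r z.1 = p z.2} :=
  h𝔈.continuousOn_inner (a := fun z : G × X => z.2) (k.2.1.comp_continuousOn continuous_snd.continuousOn)
    (𝒜.continuousOn_translate l.2.1)

include h𝔈 in
variable (𝒜) in
lemma continuousOn_inner_translate_left (k l : CcSection q E) (g : G) :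
    ContinuousOn (fun x => inner ℂ (k.1 x) (𝒜.translate g l.1 x)) (p ⁻¹' {𝒢.r g}) :=
  (𝒜.continuousOn_inner_translate h𝔈 k l).comp (f := fun x => (g, x)) (by fun_prop)
    fun _ hx => Eq.symm hx

include h𝔈 in
variable (𝒜) in
lemma integrable_inner_translate (k l : CcSection q E) (g : G) :
    Integrable (fun x => inner ℂ (k.1 x) (𝒜.translate g l.1 x)) (mu.meas (𝒢.r g)) := by
  obtain ⟨K, hK, hk⟩ := k.2.2
  exact mu.integrable (𝒜.continuousOn_inner_translate_left h𝔈 k l g) hK fun x _ hx => by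
    rw [hk x hx, inner_zero_left]

variable (𝒜) in
/-- The `C_c(G)`-valued inner product of continuous sections with compact support. -/
def ccInner (k l : CcSection q E) : C_c(G, ℂ) where
  -- `inner` is conjugate linear in its first variable, so it is the complex conjugate of the metric
  -- in the opposite convention.
  toFun g := ∫ x, inner ℂ (k.1 x) (𝒜.translate g l.1 x) ∂(mu.meas (𝒢.r g))
  continuous_toFun := by
    obtain ⟨K, hK, hk⟩ := k.2.2
    exact mu.continuous_integral_fibre 𝒢.continuous_r
      (F := fun g x => inner ℂ (k.1 x) (𝒜.translate g l.1 x))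
      (𝒜.continuousOn_inner_translate h𝔈 k l) hK fun g x _ hx => by
        rw [hk x hx, inner_zero_left]
  hasCompactSupport' := by
    obtain ⟨K, hK, hk⟩ := k.2.2
    obtain ⟨L, hL, hl⟩ := l.2.2
    -- By properness, the arrows `g` for which `gL` meets `K` form a compact set.
    refine HasCompactSupport.intro ((hα _ (hK.prod hL)).image continuous_fst) fun g hg =>
      integral_eq_zero_of_ae ?_
    filter_upwards [mu.ae_mem (𝒢.r g)] with x hx
    by_contra hne
    refine hg ⟨(g, α.smul (𝒢.inv g) x), ⟨(α.p_inv_smul g x hx.symm).symm, ?_, ?_⟩, rfl⟩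
    · change α.smul g (α.smul (𝒢.inv g) x) ∈ K
      rw [α.smul_inv_smul g x hx.symm]
      by_contra h
      exact hne (by simp [hk _ h])
    · by_contra h
      exact hne (by simp [𝒜.translate_of_eq_zero g l.1 x hx.symm (hl _ h)])

lemma ccInner_apply (k l : CcSection q E) (g : G) :
    𝒜.ccInner mu h𝔈 hα k l g = ∫ x, inner ℂ (k.1 x) (𝒜.translate g l.1 x) ∂(mu.meas (𝒢.r g)) :=
  rfl

/-- By `translate_rightAct`, both sides integrate `⟨k(x), L_t l(x)⟩ f(t⁻¹g)` over `x` and `t`, in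
opposite orders. -/
lemma ccInner_rightAct (k l : CcSection q E) (f : C_c(G, ℂ)) :
    𝒜.ccInner mu h𝔈 hα k (𝒜.rightAct lam l f) = lam.mul (𝒜.ccInner mu h𝔈 hα k l) f := by
  ext g
  set F : X → G → ℂ := fun x t =>
    inner ℂ (k.1 x) (𝒜.translate t l.1 x) * f (𝒢.mul (𝒢.inv t) g) with hF
  obtain ⟨K, hK, hk⟩ := k.2.2
  have hFc : ContinuousOn (fun w : X × G => F w.1 w.2)
      ((p ⁻¹' {𝒢.r g}) ×ˢ (𝒢.r ⁻¹' {𝒢.r g})) := by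
    refine ((𝒜.continuousOn_inner_translate h𝔈 k l).comp (f := fun w : X × G => (w.2, w.1))
      (by fun_prop) ?_).mul (f.continuous.comp_continuousOn (𝒢.continuousOn_inv_mul.comp
        (f := fun w : X × G => (w.2, g)) (by fun_prop) fun w hw => hw.2))
    intro w hw
    exact Eq.trans hw.2 (Eq.symm hw.1)
  have hswap := integral_integral_swap_of_continuousOn (𝔛.isClosed_fibre _) (𝔊.isClosed_fibre _)
    (mu.concentrated _) (lam.concentrated _) hFc hK
    (𝒢.leftMul.isCompact_smulSet 𝒢.continuous_r (isCompact_singleton (x := g))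
      (isCompact_inv_tsupport 𝒢 f)) (by
    intro x _ t ht hne
    refine ⟨?_, 𝒢.mem_smulSet_of_inv_mul_mem ht (mem_singleton g)
      (mem_tsupport_of_ne_zero f (right_ne_zero_of_mul hne))⟩
    by_contra hn
    exact hne (by simp [hF, hk x hn]))
  have hL : 𝒜.ccInner mu h𝔈 hα k (𝒜.rightAct lam l f) g
      = ∫ x, ∫ t, F x t ∂(lam.meas (𝒢.r g)) ∂(mu.meas (𝒢.r g)) := by
    rw [ccInner_apply]
    refine integral_congr_ae ?_
    filter_upwards [mu.ae_mem (𝒢.r g)] with x hx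
    have := finiteDimensional_fibre (E := E) q x
    have := FiniteDimensional.complete ℂ (E x)
    rw [𝒜.translate_rightAct lam l f g x hx.symm,
      ← integral_inner (𝒜.integrable_translate_rightAct lam l f hx.symm), hx]
    simp only [hF, inner_smul_right, mul_comm]
  have hR : lam.mul (𝒜.ccInner mu h𝔈 hα k l) f g
      = ∫ t, ∫ x, F x t ∂(mu.meas (𝒢.r g)) ∂(lam.meas (𝒢.r g)) := by
    rw [lam.mul_apply]
    refine integral_congr_ae ?_
    filter_upwards [lam.ae_mem (𝒢.r g)] with t ht
    rw [hF, integral_mul_const, ccInner_apply, ht]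
  rw [hL, hR, hswap]

include hiso in
-- Substitute `x ↦ gx` and apply `g⁻¹` to both arguments of the metric, which is isometric.
lemma invol_ccInner (k l : CcSection q E) :
    𝒢.invol (𝒜.ccInner mu h𝔈 hα k l) = 𝒜.ccInner mu h𝔈 hα l k := by
  ext g
  rw [𝒢.invol_apply, ccInner_apply, ccInner_apply, 𝒢.r_inv,
    ← mu.integral_smul g rfl (𝒜.continuousOn_inner_translate_left h𝔈 l k g)]
  change starRingEnd ℂ _ = _
  rw [← integral_conj]
  refine integral_congr_ae ?_
  filter_upwards [mu.ae_mem (𝒢.s g)] with x hx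
  have hr : 𝒢.r (𝒢.inv g) = p x := by rw [𝒢.r_inv, hx]
  have h1 := hiso.inner_translate (𝒢.inv g) (𝒜.translate g k.1) l.1 x hr
  rw [𝒜.translate_translate _ _ _ _ (𝒢.s_inv g) hr, 𝒢.inv_mul, ← hx, 𝒜.translate_unit,
    𝒢.inv_inv] at h1
  rw [h1, inner_conj_symm]

/-- Units act trivially. Both positivity and definiteness are read off from this value. -/
lemma ccInner_unit (k : CcSection q E) (u : B) :
    𝒜.ccInner mu h𝔈 hα k k (𝒢.unit u) = ((∫ x, ‖k.1 x‖ ^ 2 ∂(mu.meas u) : ℝ) : ℂ) := by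
  rw [ccInner_apply, 𝒢.r_unit, ← integral_complex_ofReal]
  refine integral_congr_ae ?_
  filter_upwards [mu.ae_mem u] with x hx
  rw [← hx, 𝒜.translate_unit, inner_self_eq_norm_sq_to_K]
  push_cast
  rfl

lemma ccInner_definite (k : CcSection q E) (h : 𝒜.ccInner mu h𝔈 hα k k = 0) : k = 0 := by
  refine Subtype.ext (funext fun x => ?_)
  have hc : Continuous fun x => ‖k.1 x‖ ^ 2 := by
    have := h𝔈.continuousOn_inner (S := univ) (a := id) k.2.1.continuousOn k.2.1.continuousOn
    rw [continuousOn_univ] at this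
    refine (Complex.continuous_re.comp this).congr fun x => ?_
    exact (norm_sq_eq_re_inner (𝕜 := ℂ) (k.1 x)).symm
  have h1 := ccInner_unit (𝒜 := 𝒜) mu h𝔈 hα k (p x)
  rw [h, CompactlySupportedContinuousMap.zero_apply, eq_comm, Complex.ofReal_eq_zero] at h1
  obtain ⟨K, hK, hk⟩ := k.2.2
  rw [integral_eq_zero_iff_of_nonneg (fun t => by positivity)
    (mu.integrable hc.continuousOn hK fun t _ ht => by simp [hk t ht])] at h1
  simpa using mu.eq_zero_of_ae hc.continuousOn h1 x rfl

include hiso in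
-- `ξ^* * ⟨k,k⟩ * ξ = ⟨kξ, kξ⟩`, whose value at a unit is the squared `L²` norm of `kξ` on the
-- fibre.
lemma toRed_ccInner_nonneg (k : CcSection q E) : 0 ≤ lam.toRed (𝒜.ccInner mu h𝔈 hα k k) := by
  refine lam.toRed_nonneg fun ξ u => ?_
  have : lam.mul (𝒢.invol ξ) (lam.mul (𝒜.ccInner mu h𝔈 hα k k) ξ) =
      𝒜.ccInner mu h𝔈 hα (𝒜.rightAct lam k ξ) (𝒜.rightAct lam k ξ) := by
    rw [← ccInner_rightAct, ← invol_ccInner mu h𝔈 hα hiso, ← lam.invol_mul, ← ccInner_rightAct,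
      invol_ccInner mu h𝔈 hα hiso]
  rw [this, ccInner_unit]
  exact Complex.zero_le_real.2 (integral_nonneg fun x => by positivity)

include hiso in
theorem isPreHilbertModule_ccSection :
    IsPreHilbertModule lam.mul 𝒢.invol lam.toRed (𝒜.ccInner mu h𝔈 hα) (𝒜.rightAct lam) where
  add_act k l f := by
    refine Subtype.ext (funext fun x => ?_)
    change (𝒜.rightAct lam (k + l) f).1 x = (𝒜.rightAct lam k f).1 x + (𝒜.rightAct lam l f).1 x
    rw [rightAct_apply, rightAct_apply, rightAct_apply]
    rw [← integral_add (𝒜.integrable_act lam k f x) (𝒜.integrable_act lam l f x)]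
    refine integral_congr_ae ?_
    filter_upwards [lam.ae_mem (p x)] with g hg
    change f _ • 𝒜.translate g (k.1 + l.1) x = _
    rw [𝒜.translate_add g _ _ x hg, _root_.smul_add]
  act_add k f h := by
    refine Subtype.ext (funext fun x => ?_)
    change (𝒜.rightAct lam k (f + h)).1 x = (𝒜.rightAct lam k f).1 x + (𝒜.rightAct lam k h).1 x
    rw [rightAct_apply, rightAct_apply, rightAct_apply]
    rw [← integral_add (𝒜.integrable_act lam k f x) (𝒜.integrable_act lam k h x)]
    simp only [CompactlySupportedContinuousMap.add_apply, add_smul]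
  smul_act c k f := by
    refine Subtype.ext (funext fun x => ?_)
    change (𝒜.rightAct lam (c • k) f).1 x = c • (𝒜.rightAct lam k f).1 x
    rw [rightAct_apply, rightAct_apply]
    rw [← integral_smul]
    refine integral_congr_ae ?_
    filter_upwards [lam.ae_mem (p x)] with g hg
    change f _ • 𝒜.translate g (c • k.1) x = _
    rw [𝒜.translate_smul g _ _ x hg, smul_comm]
  act_smul c k f := by
    refine Subtype.ext (funext fun x => ?_)
    change (𝒜.rightAct lam k (c • f)).1 x = c • (𝒜.rightAct lam k f).1 x
    rw [rightAct_apply, rightAct_apply]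
    rw [← integral_smul]
    simp only [CompactlySupportedContinuousMap.smul_apply, smul_assoc]
  act_mul := 𝒜.rightAct_mul lam
  ip_add k l m := by
    ext g
    rw [CompactlySupportedContinuousMap.add_apply, ccInner_apply, ccInner_apply, ccInner_apply,
      ← integral_add (𝒜.integrable_inner_translate mu h𝔈 k l g)
        (𝒜.integrable_inner_translate mu h𝔈 k m g)]
    refine integral_congr_ae ?_
    filter_upwards [mu.ae_mem (𝒢.r g)] with x hx
    change inner ℂ _ (𝒜.translate g (l.1 + m.1) x) = _
    rw [𝒜.translate_add g _ _ x hx.symm, inner_add_right]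
  ip_smul c k l := by
    ext g
    rw [CompactlySupportedContinuousMap.smul_apply, ccInner_apply, ccInner_apply, ← integral_smul]
    refine integral_congr_ae ?_
    filter_upwards [mu.ae_mem (𝒢.r g)] with x hx
    change inner ℂ _ (𝒜.translate g (c • l.1) x) = _
    rw [𝒜.translate_smul g _ _ x hx.symm, inner_smul_right, smul_eq_mul]
  ip_act := ccInner_rightAct lam mu h𝔈 hα
  invol_ip := invol_ccInner mu h𝔈 hα hiso
  nonneg := toRed_ccInner_nonneg lam mu h𝔈 hα hiso
  definite := ccInner_definite mu h𝔈 hα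

end GBundle

end CFG

end

theorem mainTheorem10
    {G B X : Type*}
    [TopologicalSpace G] [LocallyCompactSpace G] [T2Space G] [SecondCountableTopology G]
    [MeasurableSpace G] [BorelSpace G] [TopologicalSpace B]
    [TopologicalSpace X] [LocallyCompactSpace X] [T2Space X] [SecondCountableTopology X]
    [MeasurableSpace X] [BorelSpace X]
    -- the continuous family groupoid, with a left Haar system
    (𝒢 : CFG.TopGroupoid G B) {m : ℕ} (𝔊 : CFG.ContFamilyGroupoid 𝒢 m)
    (lam : CFG.SmoothHaarSystem 𝒢.leftMul 𝔊.famR)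
    -- the proper, `G`-compact `G`-space, with a left Haar system
    {p : X → B} {n : ℕ} (𝔛 : CFG.ContFamily p n) (α : CFG.GroupoidAction 𝒢 p)
    (hα : α.IsSmooth 𝔛) (hproper : α.IsProper) (hcompact : α.IsGCompact)
    (mu : CFG.SmoothHaarSystem α 𝔛)
    -- the `G`-vector bundle, with an isometric hermitian metric
    {q : ℕ} {E : X → Type*} [∀ x, NormedAddCommGroup (E x)] [∀ x, InnerProductSpace ℂ (E x)]
    [TopologicalSpace (Bundle.TotalSpace (CFG.Fib q) E)] [FiberBundle (CFG.Fib q) E]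
    [VectorBundle ℂ (CFG.Fib q) E]
    (𝔈 : CFG.SmoothBundle 𝔛 q E) (hmetric : 𝔈.SmoothMetric)
    (𝒜 : CFG.GBundle α 𝔈) (hiso : 𝒜.IsIsometric) :
    ∃ (mul : C_c(G, ℂ) → C_c(G, ℂ) → C_c(G, ℂ)) (invol : C_c(G, ℂ) → C_c(G, ℂ))
      (ι : C_c(G, ℂ) →ₗ[ℂ] CFG.CStarRed 𝒢 lam.meas)
      (ip : CFG.CcSection q E → CFG.CcSection q E → C_c(G, ℂ))
      (act : CFG.CcSection q E → C_c(G, ℂ) → CFG.CcSection q E),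
      -- the convolution *-algebra `C_c(G)` and its inclusion in the reduced C*-algebra
      (∀ f g x, mul f g x = CFG.conv 𝒢 lam.meas f g x) ∧
      (∀ f x, invol f x = star (f (𝒢.inv x))) ∧
      (∀ f u, CFG.IsRegRep 𝒢 lam.meas u f ((ι f).op u)) ∧
      CFG.IsDenseStarEmbedding mul invol ι ∧
      -- the inner product and the action
      (∀ (k₁ k₂ : CFG.CcSection q E) (g : G),
        Integrable (fun x => inner ℂ (k₁.1 x) (𝒜.translate g k₂.1 x)) (mu.meas (𝒢.r g)) ∧
        ip k₁ k₂ g = ∫ x, inner ℂ (k₁.1 x) (𝒜.translate g k₂.1 x) ∂(mu.meas (𝒢.r g))) ∧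
      (∀ (k : CFG.CcSection q E) (f : C_c(G, ℂ)) (x : X),
        Integrable (fun g => f (𝒢.inv g) • 𝒜.translate g k.1 x) (lam.meas (p x)) ∧
        (act k f).1 x = ∫ g, f (𝒢.inv g) • 𝒜.translate g k.1 x ∂(lam.meas (p x))) ∧
      -- `C_c(X, E)` is a pre-Hilbert module and its completion is a Hilbert module
      CFG.IsPreHilbertModule mul invol ι ip act ∧
      CFG.CompletionIsHilbertModule ι ip act := by
  have := 𝒢.t2Space_base
  have hpre := CFG.GBundle.isPreHilbertModule_ccSection lam mu hmetric hproper hiso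
  exact ⟨lam.mul, 𝒢.invol, lam.toRed, 𝒜.ccInner mu hmetric hproper, 𝒜.rightAct lam,
    fun _ _ _ => rfl, fun _ _ => rfl, fun _ _ => lam.isRegRep_iff.2 rfl,
    lam.isDenseStarEmbedding_toRed,
    fun k l g => ⟨𝒜.integrable_inner_translate mu hmetric k l g, rfl⟩,
    fun k f x => ⟨𝒜.integrable_act lam k f x, rfl⟩, hpre,
    hpre.completionIsHilbertModule lam.isDenseStarEmbedding_toRed⟩
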